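/- Let $T>0$, $1/2<H<1$, $m\in\mathbb N$ with $m\ge 2$, $a\le 0$ and $b,c\in\mathbb R$. Let $B^H=(B^H_t)_{t\ge 0}$ be a fractional Brownian motion with Hurst index $H$ (a continuous centered Gaussian process with $\mathbf E(B^H_tB^H_s)=\frac12(s^{2H}+t^{2H}-|t-s|^{2H})$) on a filtered probability space $(\Omega,\mathcal F,(\mathcal F_t)_{t\ge0},\mathbf P)$, adapted to the filtration, and let $X_0$ be an $\mathcal F_0$-measurable random variable with $X_0>0$ almost surely. Consider on $[0,T]$ the equation $$Y_t=X_0+\int_0^t\big(aY_s^m+bY_s\big)\,ds+c\int_0^tY_s\,dB^H_s,\qquad t\in[0,T],\tag{1}$$ where the second integral is the pathwise Riemann–Stieltjes integral (the limit of tagged Riemann–Stieltjes sums as the mesh tends to $0$). A solution of (1) is an adapted process $Y=(Y_t)_{t\in[0,T]}$ with almost surely continuous paths such that $Y_0=X_0$ a.s. and, for almost every $\omega$, both integrals exist and (1) holds for all $t\in[0,T]$. Then the process $$X_t=e^{bt+cB^H_t}\Big(X_0^{1-m}+(1-m)a\int_0^te^{(m-1)(bs+cB^H_s)}\,ds\Big)^{1/(1-m)},\qquad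 t\in[0,T],$$ has the following properties. 1. For almost every $\omega$, the path $t\mapsto X_t(\omega)$ is, for every $\varepsilon\in(0,H)$, continuous and of bounded $\frac1{H-\varepsilon}$-variation on $[0,T]$, where $f$ has bounded $p$-variation on $[0,T]$ if $\sup\sum_{k=1}^n|f(x_k)-f(x_{k-1})|^p<\infty$, the supremum being over all partitions $0=x_0<x_1<\dots<x_n=T$. 2. $X$ is a solution of (1). 3. The solution is unique: for almost every $\omega$, any continuous function $y:[0,T]\to\mathbb R$ for which the Riemann–Stieltjes integrals $\int_0^t y_s\,dB^H_s(\omega)$ exist and which satisfies $y_t=X_0(\omega)+\int_0^t(ay_s^m+by_s)\,ds+c\int_0^ty_s\,dB^H_s(\omega)$ for all $t\in[0,T]$ coincides with $t\mapsto X_t(\omega)$ on $[0,T]$. In particular, every solution $Y$ of (1) satisfies $\mathbf P(Y_t=X_t\text{ for all }t\in[0,T])=1$. -/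

import Mathlib

open MeasureTheory ProbabilityTheory Set Filter
open scoped NNReal ENNReal

/-- `x 0 < x 1 < ⋯ < x n` is a partition of `[a, b]` (for `a = b` only `n = 0` is possible). -/
structure IsPartition (a b : ℝ) (n : ℕ) (x : ℕ → ℝ) : Prop where
  left : x 0 = a
  right : x n = b
  lt_succ : ∀ i < n, x i < x (i + 1)

/-- The `p`-variation `v_p(f; [a, b]) = sup ∑ |f(x_k) - f(x_{k-1})|^p` over all partitions. -/
noncomputable def pVariation (p : ℝ) (f : ℝ → ℝ) (a b : ℝ) : ℝ≥0∞ :=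
  ⨆ (n : ℕ) (x : ℕ → ℝ) (_ : IsPartition a b n x),
    ∑ i ∈ Finset.range n, ENNReal.ofReal (|f (x (i + 1)) - f (x i)| ^ p)

/-- The class `C𝒲_p([a, b])` of continuous functions of bounded `p`-variation on `[a, b]`. -/
def MemCW (p : ℝ) (f : ℝ → ℝ) (a b : ℝ) : Prop :=
  ContinuousOn f (Icc a b) ∧ pVariation p f a b < ⊤

/-- The Riemann-Stieltjes integral `∫_a^b f dh` exists and equals `I`: the tagged sums
converge to `I` as the mesh of the partition tends to zero. -/
def HasRSIntegral (f h : ℝ → ℝ) (a b I : ℝ) : Prop :=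
  ∀ ε > 0, ∃ δ > 0, ∀ (n : ℕ) (x τ : ℕ → ℝ), IsPartition a b n x →
    (∀ i < n, x (i + 1) - x i < δ) → (∀ i < n, τ i ∈ Icc (x i) (x (i + 1))) →
    |∑ i ∈ Finset.range n, f (τ i) * (h (x (i + 1)) - h (x i)) - I| < ε

/-- `x` is a continuous solution on `[0, T]` of the deterministic integral equation
`x_t = x₀ + ∫_0^t (a x_s^m + b x_s) ds + c ∫_0^t x_s dh_s`, the last integral being a
Riemann-Stieltjes integral whose existence is part of the definition. -/
structure IsPathSolution (a b c : ℝ) (m : ℕ) (T x₀ : ℝ) (h x : ℝ → ℝ) : Prop where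
  continuousOn : ContinuousOn x (Icc 0 T)
  integrable : ∀ t ∈ Icc 0 T,
    IntervalIntegrable (fun s => a * x s ^ m + b * x s) volume 0 t
  equation : ∀ t ∈ Icc 0 T, ∃ I : ℝ, HasRSIntegral x h 0 t I ∧
    x t = x₀ + (∫ s in (0 : ℝ)..t, (a * x s ^ m + b * x s)) + c * I

/-- The sample path of a process indexed by `[0, ∞)`, as a function on `ℝ` (of which only the
values at nonnegative times are ever used). -/
def samplePath {Ω : Type*} (X : ℝ≥0 → Ω → ℝ) (ω : Ω) : ℝ → ℝ :=
  fun s => X s.toNNReal ω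

/-- `B` is a fractional Brownian motion with Hurst index `H`: a continuous centered Gaussian
process with `E (B_t B_s) = (s^{2H} + t^{2H} - |t - s|^{2H}) / 2`. -/
structure IsFractionalBrownianMotion {Ω : Type*} [MeasurableSpace Ω] (H : ℝ)
    (B : ℝ≥0 → Ω → ℝ) (P : Measure Ω) : Prop where
  gaussian : IsGaussianProcess B P
  continuous : ∀ ω, Continuous fun t => B t ω
  centered : ∀ t, ∫ ω, B t ω ∂P = 0
  covariance : ∀ s t : ℝ≥0, ∫ ω, B t ω * B s ω ∂P =
    ((s : ℝ) ^ (2 * H) + (t : ℝ) ^ (2 * H) - |(t : ℝ) - s| ^ (2 * H)) / 2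

/-- `X` is a solution on `[0, T]` of
`X_t = ξ + ∫_0^t (a X_s^m + b X_s) ds + c ∫_0^t X_s dB_s`:
it is adapted, and almost all of its sample paths are continuous and satisfy the equation. -/
structure IsSDESolution {Ω : Type*} [mΩ : MeasurableSpace Ω] (P : Measure Ω)
    (𝓕 : Filtration ℝ≥0 mΩ) (B : ℝ≥0 → Ω → ℝ) (ξ : Ω → ℝ) (a b c : ℝ) (m : ℕ) (T : ℝ≥0)
    (X : ℝ≥0 → Ω → ℝ) : Prop where
  adapted : ∀ t ≤ T, Measurable[𝓕 t] (X t)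
  initial : ∀ᵐ ω ∂P, X 0 ω = ξ ω
  equation : ∀ᵐ ω ∂P,
    IsPathSolution a b c m T (ξ ω) (samplePath B ω) (samplePath X ω)

/-- The process
`e^{bt + cB_t} (ξ^{1-m} + (1-m) a ∫_0^t e^{(m-1)(bs + cB_s)} ds)^{1/(1-m)}`. -/
noncomputable def explicitProcess {Ω : Type*} (B : ℝ≥0 → Ω → ℝ) (ξ : Ω → ℝ) (a b c : ℝ) (m : ℕ) :
    ℝ≥0 → Ω → ℝ :=
  fun t ω => Real.exp (b * t + c * B t ω) *
    (ξ ω ^ (1 - m : ℝ) + (1 - m : ℝ) * a *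
      ∫ s in (0 : ℝ)..t, Real.exp ((m - 1 : ℝ) * (b * s + c * samplePath B ω s))) ^
      (1 / (1 - m : ℝ))

/-! The argument is pathwise. Since `H > 1/2`, almost every noise path `h` is `γ`-Hölder for some `γ
> 1/2` (Gaussian moments and dyadic chaining, `ae_holderBound`). Second-order Taylor errors over a
cell `[u, v]` are then `O((v - u)^{2γ}) = o(v - u)` and vanish in the limit of Riemann–Stieltjes
sums, so the ordinary chain and product rules hold without correction term
(`hasRSIntegral_mul_comp`).

Existence: the explicit path is `A e^{ch}` with `A` of class `C¹`, and the equation reduces to the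
Bernoulli ODE that `A` satisfies. As `a ≤ 0`, the base of the real power stays positive.

Uniqueness: a competing solution `y` is only continuous, so no Young-type bound is available for the
error `|I_v - I_u - y_u (h_v - h_u)|` on a single cell, `I` being the integral process. The
Saks–Henstock lemma shows that these errors still have an arbitrarily small sum over fine
partitions. This is enough to prove that `z = y e^{-ch}` satisfies `z' = a e^{(m-1)ch} z^m + b z` in
integrated form (`IsPathSolution.mul_exp_eq`), an equation with a locally Lipschitz right-hand side
(`IsPathSolution.eqOn`). -/

/-! ### Negligible functions of tagged intervals -/

/-- A function of a tagged interval `u ≤ τ ≤ v` inside `[0, T]` which is `o(v - u)` uniformly. -/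
def IsSmallCell (T : ℝ) (Φ : ℝ → ℝ → ℝ → ℝ) : Prop :=
  ∀ η > 0, ∃ δ > 0, ∀ u τ v, 0 ≤ u → u ≤ τ → τ ≤ v → v ≤ T → v - u < δ →
    |Φ u τ v| ≤ η * (v - u)

namespace IsSmallCell

variable {T : ℝ} {Φ Ψ : ℝ → ℝ → ℝ → ℝ}

lemma mono (hΦ : IsSmallCell T Φ)
    (h : ∀ u τ v, 0 ≤ u → u ≤ τ → τ ≤ v → v ≤ T → |Ψ u τ v| ≤ |Φ u τ v|) :
    IsSmallCell T Ψ := by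
  intro η hη
  obtain ⟨δ, hδ, H⟩ := hΦ η hη
  exact ⟨δ, hδ, fun u τ v h0 h1 h2 h3 h4 =>
    (h u τ v h0 h1 h2 h3).trans (H u τ v h0 h1 h2 h3 h4)⟩

lemma congr (hΦ : IsSmallCell T Φ)
    (h : ∀ u τ v, 0 ≤ u → u ≤ τ → τ ≤ v → v ≤ T → Ψ u τ v = Φ u τ v) : IsSmallCell T Ψ :=
  hΦ.mono fun u τ v h0 h1 h2 h3 => by rw [h u τ v h0 h1 h2 h3]

lemma add (hΦ : IsSmallCell T Φ) (hΨ : IsSmallCell T Ψ) :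
    IsSmallCell T fun u τ v => Φ u τ v + Ψ u τ v := by
  intro η hη
  obtain ⟨δ, hδ, H⟩ := hΦ (η / 2) (half_pos hη)
  obtain ⟨δ', hδ', H'⟩ := hΨ (η / 2) (half_pos hη)
  refine ⟨min δ δ', lt_min hδ hδ', fun u τ v h0 h1 h2 h3 h4 => ?_⟩
  have e1 := H u τ v h0 h1 h2 h3 (h4.trans_le (min_le_left _ _))
  have e2 := H' u τ v h0 h1 h2 h3 (h4.trans_le (min_le_right _ _))
  have e3 := abs_add_le (Φ u τ v) (Ψ u τ v)
  linarith

lemma bdd_mul (hΦ : IsSmallCell T Φ) {g : ℝ → ℝ → ℝ → ℝ} {M : ℝ}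
    (hg : ∀ u τ v, 0 ≤ u → u ≤ τ → τ ≤ v → v ≤ T → |g u τ v| ≤ M) :
    IsSmallCell T fun u τ v => g u τ v * Φ u τ v := by
  intro η hη
  obtain ⟨δ, hδ, H⟩ := hΦ (η / (|M| + 1)) (by positivity)
  refine ⟨δ, hδ, fun u τ v h0 h1 h2 h3 h4 => ?_⟩
  have e1 := H u τ v h0 h1 h2 h3 h4
  have e2 : |g u τ v| ≤ |M| + 1 :=
    (hg u τ v h0 h1 h2 h3).trans ((le_abs_self M).trans (by linarith))
  calc |g u τ v * Φ u τ v| = |g u τ v| * |Φ u τ v| := abs_mul _ _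
    _ ≤ (|M| + 1) * (η / (|M| + 1) * (v - u)) := by gcongr
    _ = η * (v - u) := by field_simp

/-- A quantity that is at most `K (v - u) ^ θ` with `θ > 1` is `o(v - u)`. -/
lemma of_rpow {θ K : ℝ} (hθ : 1 < θ)
    (h : ∀ u τ v, 0 ≤ u → u ≤ τ → τ ≤ v → v ≤ T → |Φ u τ v| ≤ K * (v - u) ^ θ) :
    IsSmallCell T Φ := by
  intro η hη
  have hK : 0 < η / (|K| + 1) := by positivity
  have hθ' : 0 < θ - 1 := by linarith
  -- This `δ` solves `(|K| + 1) δ ^ (θ - 1) = η`.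
  refine ⟨(η / (|K| + 1)) ^ (1 / (θ - 1)), Real.rpow_pos_of_pos hK _,
    fun u τ v h0 h1 h2 h3 h4 => ?_⟩
  have huv : 0 ≤ v - u := by linarith
  have e : (v - u) ^ θ = (v - u) ^ (θ - 1) * (v - u) := by
    rcases huv.eq_or_lt with h | h
    · rw [← h, Real.zero_rpow (by linarith), mul_zero]
    · rw [Real.rpow_sub_one h.ne']; field_simp
  have e1 : (v - u) ^ (θ - 1) ≤ η / (|K| + 1) := by
    calc (v - u) ^ (θ - 1) ≤ ((η / (|K| + 1)) ^ (1 / (θ - 1))) ^ (θ - 1) :=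
          Real.rpow_le_rpow huv h4.le hθ'.le
      _ = η / (|K| + 1) := by
          rw [← Real.rpow_mul hK.le, one_div_mul_cancel hθ'.ne', Real.rpow_one]
  calc |Φ u τ v| ≤ K * (v - u) ^ θ := h u τ v h0 h1 h2 h3
    _ ≤ (|K| + 1) * ((v - u) ^ (θ - 1) * (v - u)) := by
        rw [e]
        have : K ≤ |K| + 1 := (le_abs_self K).trans (by linarith)
        gcongr
    _ ≤ (|K| + 1) * (η / (|K| + 1) * (v - u)) := by gcongr
    _ = η * (v - u) := by field_simp

end IsSmallCell

lemma exists_abs_le_of_continuousOn_Icc {f : ℝ → ℝ} {a b : ℝ} (hf : ContinuousOn f (Icc a b)) :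
    ∃ M, 0 ≤ M ∧ ∀ t ∈ Icc a b, |f t| ≤ M := by
  obtain ⟨C, hC⟩ := isCompact_Icc.exists_bound_of_continuousOn hf
  exact ⟨|C|, abs_nonneg C, fun t ht => (hC t ht).trans (le_abs_self C)⟩

/-- Uniform continuity on `[0, T]` in the form used for sums over partitions. -/
lemma exists_modulus {k : ℝ → ℝ} {T : ℝ} (hk : ContinuousOn k (Icc 0 T)) {η : ℝ} (hη : 0 < η) :
    ∃ δ > 0, ∀ s ∈ Icc 0 T, ∀ t ∈ Icc 0 T, |s - t| < δ → |k s - k t| < η := by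
  have := isCompact_Icc.uniformContinuousOn_of_continuous hk
  rw [Metric.uniformContinuousOn_iff] at this
  simpa [Real.dist_eq] using this η hη

/-- Freezing `k` at a point of the cell costs at most its oscillation there times `sup |p|` times
the length. -/
lemma isSmallCell_integral_mul {p k : ℝ → ℝ} {T : ℝ} (hp : ContinuousOn p (Icc 0 T))
    (hk : ContinuousOn k (Icc 0 T)) {σ : ℝ → ℝ → ℝ → ℝ}
    (hσ : ∀ u τ v, u ≤ τ → τ ≤ v → σ u τ v ∈ Icc u v) :
    IsSmallCell T fun u τ v =>
      k (σ u τ v) * (∫ s in u..v, p s) - ∫ s in u..v, k s * p s := by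
  intro η hη
  obtain ⟨M, hM0, hM⟩ := exists_abs_le_of_continuousOn_Icc hp
  obtain ⟨δ, hδ, hmod⟩ := exists_modulus hk (η := η / (M + 1)) (by positivity)
  refine ⟨δ, hδ, fun u τ v h0 h1 h2 h3 h4 => ?_⟩
  have huv : u ≤ v := h1.trans h2
  have hsub : Icc u v ⊆ Icc 0 T := Icc_subset_Icc h0 h3
  have hsub' : uIcc u v ⊆ Icc 0 T := by rwa [uIcc_of_le huv]
  have i1 : IntervalIntegrable p volume u v := (hp.mono hsub').intervalIntegrable
  have i2 : IntervalIntegrable (fun s => k s * p s) volume u v :=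
    ((hk.mul hp).mono hsub').intervalIntegrable
  beta_reduce
  rw [← intervalIntegral.integral_const_mul,
    ← intervalIntegral.integral_sub (i1.const_mul _) i2]
  have hs := hσ u τ v h1 h2
  have := intervalIntegral.norm_integral_le_of_norm_le_const (a := u) (b := v)
    (f := fun s => k (σ u τ v) * p s - k s * p s) (C := η) ?_
  · rwa [Real.norm_eq_abs, abs_of_nonneg (sub_nonneg.2 huv)] at this
  · intro s hs'
    rw [uIoc_of_le huv] at hs'
    have hs'' : s ∈ Icc u v := Ioc_subset_Icc_self hs'
    rw [← sub_mul, norm_mul, Real.norm_eq_abs, Real.norm_eq_abs]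
    have e1 := hmod _ (hsub hs) _ (hsub hs'') (by
      rw [abs_lt]; constructor <;> linarith [hs.1, hs.2, hs''.1, hs''.2])
    have e2 := hM s (hsub hs'')
    calc _ ≤ η / (M + 1) * (M + 1) := by gcongr; linarith
      _ = η := by field_simp

/-! ### Hölder paths and the Taylor error -/

/-- Functions with `|h t - h s| ≤ C |t - s| ^ γ` on `[0, T]`. -/
def HolderBound (C γ : ℝ) (h : ℝ → ℝ) (T : ℝ) : Prop :=
  ∀ s ∈ Icc 0 T, ∀ t ∈ Icc 0 T, |h t - h s| ≤ C * |t - s| ^ γ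

lemma HolderBound.nonneg_const {C γ T : ℝ} {h : ℝ → ℝ} (hh : HolderBound C γ h T) (hT : 0 < T) :
    0 ≤ C := by
  have := (abs_nonneg _).trans (hh 0 ⟨le_rfl, hT.le⟩ T ⟨hT.le, le_rfl⟩)
  rw [sub_zero] at this
  exact nonneg_of_mul_nonneg_left this (Real.rpow_pos_of_pos (abs_pos.2 hT.ne') _)

/-- Mean value inequality for `x ↦ E x - e r * x`, whose derivative `e x - e r` is at most `L R`
between `p` and `q`. The point `r` need not lie between them, because the noise at a tag need not
lie between its endpoint values. -/
lemma abs_sub_sub_mul_le {E e e₁ : ℝ → ℝ} (hE : ∀ x, HasDerivAt E (e x) x)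
    (he : ∀ x, HasDerivAt e (e₁ x) x) {M L : ℝ} (hL : ∀ x ∈ Icc (-M) M, |e₁ x| ≤ L)
    {p q r R : ℝ} (hp : |p| ≤ M) (hq : |q| ≤ M) (hr : |r| ≤ M) (hpr : |p - r| ≤ R)
    (hqr : |q - r| ≤ R) : |E q - E p - e r * (q - p)| ≤ L * R * |q - p| := by
  have hL0 : 0 ≤ L := (abs_nonneg _).trans (hL p (abs_le.1 hp))
  have key := (convex_uIcc p q).norm_image_sub_le_of_norm_hasDerivWithin_le
    (f := fun x => E x - e r * x) (f' := fun x => e x - e r * 1) (C := L * R)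
    (fun x _ => ((hE x).sub ((hasDerivAt_id x).const_mul (e r))).hasDerivWithinAt)
    (fun x hx => ?_) left_mem_uIcc right_mem_uIcc
  · have e1 : E q - E p - e r * (q - p) = E q - e r * q - (E p - e r * p) := by ring
    rw [e1]; exact key
  · have hsegM : uIcc p q ⊆ Icc (-M) M := uIcc_subset_Icc (abs_le.1 hp) (abs_le.1 hq)
    have hxR : |x - r| ≤ R := by
      have : uIcc p q ⊆ Icc (r - R) (r + R) := by
        apply uIcc_subset_Icc <;> constructor <;>
          linarith [(abs_le.1 hpr).1, (abs_le.1 hpr).2, (abs_le.1 hqr).1, (abs_le.1 hqr).2]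
      have := this hx
      rw [abs_le]; constructor <;> linarith [this.1, this.2]
    have := (convex_Icc (-M) M).norm_image_sub_le_of_norm_hasDerivWithin_le (C := L)
      (fun x _ => (he x).hasDerivWithinAt) hL (abs_le.1 hr) (hsegM hx)
    rw [mul_one]
    exact this.trans (by rw [Real.norm_eq_abs]; gcongr)

/-- The only place where `γ > 1/2` does its work: the error is quadratic in the oscillation of `h`,
hence `O((v - u)^{2γ})` with `2γ > 1`. The map `σ` is left free since existence uses an arbitrary
tag and uniqueness the right endpoint. -/
lemma isSmallCell_taylor {E e e₁ h : ℝ → ℝ} {C γ T : ℝ} (hE : ∀ x, HasDerivAt E (e x) x)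
    (he : ∀ x, HasDerivAt e (e₁ x) x) (he₁ : Continuous e₁) (hh : ContinuousOn h (Icc 0 T))
    (hγ : 1 / 2 < γ) (hC : 0 ≤ C) (hol : HolderBound C γ h T) {σ : ℝ → ℝ → ℝ → ℝ}
    (hσ : ∀ u τ v, u ≤ τ → τ ≤ v → σ u τ v ∈ Icc u v) :
    IsSmallCell T fun u τ v => E (h v) - E (h u) - e (h (σ u τ v)) * (h v - h u) := by
  obtain ⟨M, hM0, hM⟩ := exists_abs_le_of_continuousOn_Icc hh
  obtain ⟨L, hL0, hL⟩ := exists_abs_le_of_continuousOn_Icc (he₁.continuousOn (s := Icc (-M) M))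
  refine IsSmallCell.of_rpow (θ := 2 * γ) (K := L * C * C) (by linarith) ?_
  intro u τ v h0 h1 h2 h3
  have huv : u ≤ v := h1.trans h2
  have hsub : Icc u v ⊆ Icc 0 T := Icc_subset_Icc h0 h3
  have hu := hsub ⟨le_rfl, huv⟩
  have hv := hsub ⟨huv, le_rfl⟩
  have hs' := hσ u τ v h1 h2
  have hs := hsub hs'
  have hγ0 : 0 ≤ γ := by linarith
  have bound : ∀ x ∈ Icc u v, |h x - h (σ u τ v)| ≤ C * (v - u) ^ γ := fun x hx =>
    (hol _ hs _ (hsub hx)).trans (by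
      gcongr; rw [abs_le]; constructor <;> linarith [hs'.1, hs'.2, hx.1, hx.2])
  have := abs_sub_sub_mul_le hE he hL (hM u hu) (hM v hv) (hM _ hs)
    (bound u ⟨le_rfl, huv⟩) (bound v ⟨huv, le_rfl⟩)
  refine this.trans ?_
  have e1 := hol u hu v hv
  rw [abs_of_nonneg (sub_nonneg.2 huv)] at e1
  have hd : 0 ≤ v - u := sub_nonneg.2 huv
  calc _ ≤ L * (C * (v - u) ^ γ) * (C * (v - u) ^ γ) := by gcongr
    _ = L * C * C * ((v - u) ^ γ * (v - u) ^ γ) := by ring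
    _ = _ := by rw [← Real.rpow_add_of_nonneg hd hγ0 hγ0, two_mul]

/-! ### Partitions and the product rule for Riemann–Stieltjes integrals -/

namespace IsPartition

variable {a b : ℝ} {n : ℕ} {x : ℕ → ℝ}

lemma le_of_le (hx : IsPartition a b n x) {i j : ℕ} (hij : i ≤ j) (hj : j ≤ n) : x i ≤ x j := by
  induction j, hij using Nat.le_induction with
  | base => exact le_rfl
  | succ j hij ih => exact (ih (by omega)).trans (hx.lt_succ j (by omega)).le

lemma left_le (hx : IsPartition a b n x) {i : ℕ} (hi : i ≤ n) : a ≤ x i := by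
  simpa [hx.left] using hx.le_of_le (Nat.zero_le i) hi

lemma le_right (hx : IsPartition a b n x) {i : ℕ} (hi : i ≤ n) : x i ≤ b := by
  simpa [hx.right] using hx.le_of_le hi le_rfl

lemma sum_sub (hx : IsPartition a b n x) (F : ℝ → ℝ) :
    ∑ i ∈ Finset.range n, (F (x (i + 1)) - F (x i)) = F b - F a := by
  rw [Finset.sum_range_sub (fun i => F (x i)), hx.left, hx.right]

end IsPartition

/-- Small cells add up to at most `η` times the length of the interval. -/
lemma IsSmallCell.exists_sum_le {T : ℝ} {Φ : ℝ → ℝ → ℝ → ℝ} (hΦ : IsSmallCell T Φ) {η : ℝ}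
    (hη : 0 < η) : ∃ δ > 0, ∀ t ∈ Icc 0 T, ∀ (n : ℕ) (x τ : ℕ → ℝ), IsPartition 0 t n x →
      (∀ i < n, x (i + 1) - x i < δ) → (∀ i < n, τ i ∈ Icc (x i) (x (i + 1))) →
      |∑ i ∈ Finset.range n, Φ (x i) (τ i) (x (i + 1))| < η := by
  have hT1 : 0 < |T| + 1 := by positivity
  obtain ⟨δ, hδ, H⟩ := hΦ (η / (|T| + 1)) (by positivity)
  refine ⟨δ, hδ, fun t ht n x τ hx hmesh hτ => ?_⟩
  calc _ ≤ ∑ i ∈ Finset.range n, |Φ (x i) (τ i) (x (i + 1))| := Finset.abs_sum_le_sum_abs _ _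
    _ ≤ ∑ i ∈ Finset.range n, η / (|T| + 1) * (x (i + 1) - x i) := by
        refine Finset.sum_le_sum fun i hi => ?_
        have hi' := Finset.mem_range.1 hi
        exact H _ _ _ (hx.left_le hi'.le) (hτ i hi').1 (hτ i hi').2
          ((hx.le_right hi').trans ht.2) (hmesh i hi')
    _ = η / (|T| + 1) * t := by
        rw [← Finset.mul_sum, hx.sum_sub (fun s => s), sub_zero]
    _ < η / (|T| + 1) * (|T| + 1) := by
        have : t < |T| + 1 := (ht.2.trans (le_abs_self T)).trans_lt (by linarith)
        gcongr
    _ = η := by field_simp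

lemma hasRSIntegral_of_isSmallCell {f h F : ℝ → ℝ} {T : ℝ}
    (hF : IsSmallCell T fun u τ v => F v - F u - f τ * (h v - h u)) {t : ℝ} (ht : t ∈ Icc 0 T) :
    HasRSIntegral f h 0 t (F t - F 0) := by
  intro ε hε
  obtain ⟨δ, hδ, H⟩ := hF.exists_sum_le hε
  refine ⟨δ, hδ, fun n x τ hx hmesh hτ => ?_⟩
  have := H t ht n x τ hx hmesh hτ
  rwa [Finset.sum_sub_distrib, hx.sum_sub, abs_sub_comm] at this

/-- Integrated form of `d(A E(h)) = A e(h) dh + E(h) A' dt`: up to a small cell, `A E(h) - ∫ E(h)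
A'` has increment `A_τ e(h_τ) (h_v - h_u)`. -/
lemma hasRSIntegral_mul_comp {A A' E e e₁ h : ℝ → ℝ} {C γ T : ℝ}
    (hA : ∀ t ∈ Icc 0 T, HasDerivAt A (A' t) t) (hA' : ContinuousOn A' (Icc 0 T))
    (hE : ∀ x, HasDerivAt E (e x) x)
    (he : ∀ x, HasDerivAt e (e₁ x) x) (he₁ : Continuous e₁) (hh : ContinuousOn h (Icc 0 T))
    (hγ : 1 / 2 < γ) (hC : 0 ≤ C) (hol : HolderBound C γ h T) {t : ℝ} (ht : t ∈ Icc 0 T) :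
    HasRSIntegral (fun s => A s * e (h s)) h 0 t
      (A t * E (h t) - A 0 * E (h 0) - ∫ s in (0 : ℝ)..t, E (h s) * A' s) := by
  have hEc : Continuous E := continuous_iff_continuousAt.2 fun x => (hE x).continuousAt
  have hAc : ContinuousOn A (Icc 0 T) := fun x hx => (hA x hx).continuousAt.continuousWithinAt
  have hEh : ContinuousOn (fun s => E (h s)) (Icc 0 T) := hEc.comp_continuousOn hh
  obtain ⟨M, hM0, hM⟩ := exists_abs_le_of_continuousOn_Icc hAc
  have c1 := (isSmallCell_taylor hE he he₁ hh hγ hC hol (σ := fun _ τ _ => τ)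
    (fun u τ v h1 h2 => ⟨h1, h2⟩)).bdd_mul (g := fun _ τ _ => A τ) (M := M)
    (fun u τ v h0 h1 h2 h3 => hM τ ⟨h0.trans h1, h2.trans h3⟩)
  have ftc : ∀ u v, 0 ≤ u → u ≤ v → v ≤ T → ∫ s in u..v, A' s = A v - A u := by
    intro u v h0 h1 h2
    have hsub : uIcc u v ⊆ Icc 0 T := by rw [uIcc_of_le h1]; exact Icc_subset_Icc h0 h2
    exact intervalIntegral.integral_eq_sub_of_hasDerivAt (fun x hx => hA x (hsub hx))
      (hA'.mono hsub).intervalIntegrable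
  have c2 := isSmallCell_integral_mul hA' hEh (σ := fun _ _ v => v)
    (fun u τ v h1 h2 => ⟨h1.trans h2, le_rfl⟩)
  -- Moving the evaluation of `A` from `u` to the tag: one factor is `O(v - u)`, the other `o(1)`.
  have c3 : IsSmallCell T fun u τ v => (A τ - A u) * (E (h v) - E (h u)) := by
    obtain ⟨M', hM0', hM'⟩ := exists_abs_le_of_continuousOn_Icc hA'
    intro η hη
    obtain ⟨δ, hδ, hmod⟩ := exists_modulus hEh (η := η / (M' + 1)) (by positivity)
    refine ⟨δ, hδ, fun u τ v h0 h1 h2 h3 h4 => ?_⟩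
    have huv : u ≤ v := h1.trans h2
    have e1 : |A τ - A u| ≤ M' * (τ - u) := by
      rw [← ftc u τ h0 h1 (h2.trans h3)]
      have := intervalIntegral.norm_integral_le_of_norm_le_const (a := u) (b := τ)
        (f := A') (C := M') (fun x hx => by
          rw [uIoc_of_le h1] at hx
          exact hM' x ⟨h0.trans hx.1.le, (hx.2.trans h2).trans h3⟩)
      rwa [Real.norm_eq_abs, abs_of_nonneg (sub_nonneg.2 h1)] at this
    have e2 := hmod v ⟨h0.trans huv, h3⟩ u ⟨h0, huv.trans h3⟩
      (by rwa [abs_of_nonneg (sub_nonneg.2 huv)])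
    rw [abs_mul]
    have e3 : |A τ - A u| ≤ (M' + 1) * (v - u) := e1.trans (by gcongr; linarith)
    have e4 : 0 ≤ v - u := sub_nonneg.2 huv
    calc _ ≤ (M' + 1) * (v - u) * (η / (M' + 1)) := by gcongr
      _ = η * (v - u) := by field_simp
  have hint : ∀ u ∈ Icc 0 T, ∀ v ∈ Icc 0 T,
      IntervalIntegrable (fun s => E (h s) * A' s) volume u v := fun u hu v hv =>
    ((hEh.mul hA').mono (uIcc_subset_Icc hu hv)).intervalIntegrable
  have hcell : IsSmallCell T fun u τ v =>
      (A v * E (h v) - ∫ s in (0 : ℝ)..v, E (h s) * A' s) -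
        (A u * E (h u) - ∫ s in (0 : ℝ)..u, E (h s) * A' s) -
        A τ * e (h τ) * (h v - h u) := by
    have c4 : IsSmallCell T fun u τ v => (-1 : ℝ) * ((A τ - A u) * (E (h v) - E (h u))) :=
      c3.bdd_mul (g := fun _ _ _ => -1) (M := 1) (by simp)
    refine ((c1.add c2).add c4).congr fun u τ v h0 h1 h2 h3 => ?_
    have huv : u ≤ v := h1.trans h2
    have hT : 0 ≤ T := (h0.trans huv).trans h3
    have := intervalIntegral.integral_add_adjacent_intervals
      (hint 0 ⟨le_rfl, hT⟩ u ⟨h0, huv.trans h3⟩) (hint u ⟨h0, huv.trans h3⟩ v ⟨h0.trans huv, h3⟩)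
    rw [ftc u v h0 huv h3, ← this]
    ring
  have := hasRSIntegral_of_isSmallCell
    (F := fun v => A v * E (h v) - ∫ s in (0 : ℝ)..v, E (h s) * A' s) hcell ht
  simp only [intervalIntegral.integral_same, sub_zero] at this
  convert! this using 1
  ring

/-! ### Concatenation of tagged sums and the Saks–Henstock lemma -/

/-- `TaggedSum f h δ a b S`: the number `S` is a tagged Riemann-Stieltjes sum of `f` against `h`
over a partition of `[a, b]` of mesh less than `δ`. -/
inductive TaggedSum (f h : ℝ → ℝ) (δ a : ℝ) : ℝ → ℝ → Prop
  | nil : TaggedSum f h δ a a 0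
  | snoc {u v τ S : ℝ} : TaggedSum f h δ a u S → u < v → v - u < δ → τ ∈ Icc u v →
      TaggedSum f h δ a v (S + f τ * (h v - h u))

namespace TaggedSum

variable {f h : ℝ → ℝ} {δ a b c S S' : ℝ}

lemma append (h₁ : TaggedSum f h δ a b S) (h₂ : TaggedSum f h δ b c S') :
    TaggedSum f h δ a c (S + S') := by
  induction h₂ with
  | nil => simpa using h₁
  | snoc _ huv hδ hτ ih => rw [← add_assoc]; exact ih.snoc huv hδ hτ

lemma mono {δ' : ℝ} (hS : TaggedSum f h δ a b S) (hδ : δ ≤ δ') : TaggedSum f h δ' a b S := by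
  induction hS with
  | nil => exact nil
  | snoc _ huv h1 hτ ih => exact ih.snoc huv (h1.trans_le hδ) hτ

lemma single {τ : ℝ} (hab : a < b) (hδ : b - a < δ) (hτ : τ ∈ Icc a b) :
    TaggedSum f h δ a b (f τ * (h b - h a)) := by
  simpa using nil.snoc hab hδ hτ

lemma exists_partition (hS : TaggedSum f h δ a b S) :
    ∃ (n : ℕ) (x τ : ℕ → ℝ), IsPartition a b n x ∧ (∀ i < n, x (i + 1) - x i < δ) ∧
      (∀ i < n, τ i ∈ Icc (x i) (x (i + 1))) ∧
      ∑ i ∈ Finset.range n, f (τ i) * (h (x (i + 1)) - h (x i)) = S := by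
  induction hS with
  | nil => exact ⟨0, fun _ => a, fun _ => a, ⟨rfl, rfl, by simp⟩, by simp, by simp, by simp⟩
  | @snoc u v σ S _ huv h1 hσ ih =>
    obtain ⟨n, x, τ, hx, hmesh, hτ, hsum⟩ := ih
    have ex : ∀ i ≤ n, (if i ≤ n then x i else v) = x i := fun i hi => if_pos hi
    have ev : (if n + 1 ≤ n then x (n + 1) else v) = v := if_neg (by omega)
    refine ⟨n + 1, fun i => if i ≤ n then x i else v, fun i => if i < n then τ i else σ,
      ⟨?_, ?_, ?_⟩, ?_, ?_, ?_⟩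
    · simpa using hx.left
    · simp
    · intro i hi
      rcases Nat.lt_succ_iff_lt_or_eq.1 hi with h | rfl
      · simpa [h.le, Nat.succ_le_of_lt h] using hx.lt_succ i h
      · simpa [hx.right] using huv
    · intro i hi
      rcases Nat.lt_succ_iff_lt_or_eq.1 hi with h | rfl
      · simpa [h.le, Nat.succ_le_of_lt h] using hmesh i h
      · simpa [hx.right] using h1
    · intro i hi
      rcases Nat.lt_succ_iff_lt_or_eq.1 hi with h | rfl
      · simpa [h, h.le, Nat.succ_le_of_lt h] using hτ i h
      · simpa [hx.right] using hσ
    · rw [Finset.sum_range_succ]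
      congr 1
      · rw [← hsum]
        refine Finset.sum_congr rfl fun i hi => ?_
        have h := Finset.mem_range.1 hi
        simp [h, h.le, Nat.succ_le_of_lt h]
      · simp [hx.right]

lemma exists_of_le (f h : ℝ → ℝ) (hab : a ≤ b) (hδ : 0 < δ) : ∃ S, TaggedSum f h δ a b S := by
  -- Steps of length `δ / 2` keep the mesh strictly below `δ`; the induction removes one step from
  -- the right.
  obtain ⟨n, hn⟩ := exists_nat_ge ((b - a) / (δ / 2))
  rw [div_le_iff₀ (half_pos hδ)] at hn
  induction n generalizing b with
  | zero =>
    have : b = a := by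
      have : b - a ≤ 0 := by simpa using hn
      linarith
    exact ⟨0, this ▸ nil⟩
  | succ n ih =>
    by_cases h1 : b - a < δ / 2
    · rcases hab.eq_or_lt with rfl | hlt
      · exact ⟨0, nil⟩
      · exact ⟨_, single hlt (by linarith) ⟨le_rfl, hab⟩⟩
    · obtain ⟨S, hS⟩ := ih (b := b - δ / 2) (by linarith) (by push_cast at hn; linarith)
      exact ⟨_, hS.snoc (by linarith) (by linarith) ⟨le_rfl, by linarith⟩⟩

end TaggedSum

namespace HasRSIntegral

variable {f h : ℝ → ℝ} {I J : ℝ}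

lemma exists_taggedSum {a b : ℝ} (hI : HasRSIntegral f h a b I) {ε : ℝ} (hε : 0 < ε) :
    ∃ δ > 0, ∀ S, TaggedSum f h δ a b S → |S - I| < ε := by
  obtain ⟨δ, hδ, H⟩ := hI ε hε
  refine ⟨δ, hδ, fun S hS => ?_⟩
  obtain ⟨n, x, τ, hx, hmesh, hτ, rfl⟩ := hS.exists_partition
  exact H n x τ hx hmesh hτ

lemma eq_zero_of_same {a : ℝ} (hI : HasRSIntegral f h a a I) : I = 0 := by
  by_contra hne
  obtain ⟨δ, -, H⟩ := hI.exists_taggedSum (abs_pos.2 hne)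
  simpa using H 0 TaggedSum.nil

/-- An integral over `[s, t]` is approximated by sums as fine as one wishes. -/
lemma exists_taggedSum_sub {a s t δ η : ℝ} (has : a ≤ s) (hst : s ≤ t)
    (hI : HasRSIntegral f h a s I) (hJ : HasRSIntegral f h a t J) (hδ : 0 < δ) (hη : 0 < η) :
    ∃ S, TaggedSum f h δ s t S ∧ |S - (J - I)| < η := by
  obtain ⟨δ₁, hδ₁, H₁⟩ := hI.exists_taggedSum (half_pos hη)
  obtain ⟨δ₂, hδ₂, H₂⟩ := hJ.exists_taggedSum (half_pos hη)
  have hδ' : 0 < min δ (min δ₁ δ₂) := lt_min hδ (lt_min hδ₁ hδ₂)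
  obtain ⟨S₁, hS₁⟩ := TaggedSum.exists_of_le f h has hδ'
  obtain ⟨S₂, hS₂⟩ := TaggedSum.exists_of_le f h hst hδ'
  refine ⟨S₂, hS₂.mono (min_le_left _ _), ?_⟩
  have e1 := H₁ _ (hS₁.mono ((min_le_right _ _).trans (min_le_left _ _)))
  have e2 := H₂ _ ((hS₁.append hS₂).mono ((min_le_right _ _).trans (min_le_right _ _)))
  rw [abs_lt] at *
  constructor <;> linarith [e1.1, e1.2, e2.1, e2.2]

end HasRSIntegral

/-- The Saks-Henstock lemma for Riemann-Stieltjes integrals. -/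
lemma saks_henstock {f h I : ℝ → ℝ} {a t : ℝ} (hat : a ≤ t)
    (hI : ∀ s ∈ Icc a t, HasRSIntegral f h a s (I s)) {ε : ℝ} (hε : 0 < ε) :
    ∃ δ > 0, ∀ (n : ℕ) (x τ : ℕ → ℝ), IsPartition a t n x →
      (∀ i < n, x (i + 1) - x i < δ) → (∀ i < n, τ i ∈ Icc (x i) (x (i + 1))) →
      ∑ i ∈ Finset.range n,
        |f (τ i) * (h (x (i + 1)) - h (x i)) - (I (x (i + 1)) - I (x i))| ≤ ε := by
  obtain ⟨δ, hδ, H⟩ := (hI t ⟨hat, le_rfl⟩).exists_taggedSum (half_pos hε)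
  refine ⟨δ, hδ, fun n x τ hx hmesh hτ => ?_⟩
  set d : ℕ → ℝ := fun i =>
    f (τ i) * (h (x (i + 1)) - h (x i)) - (I (x (i + 1)) - I (x i)) with hd
  have hmem : ∀ i ≤ n, x i ∈ Icc a t := fun i hi => ⟨hx.left_le hi, hx.le_right hi⟩
  -- Keep the cells selected by `p` and replace every other one by a sum so fine that it reproduces
  -- its increment of `I` up to `η`. The result is still `δ`-fine, and its error is the sum of the
  -- selected `d i`, up to `η` per cell.
  have key : ∀ (p : ℕ → Prop) [DecidablePred p] (η : ℝ), 0 < η → ∀ k ≤ n, ∃ S, TaggedSum f h δ a (x k) S ∧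
      |S - I (x k) - ∑ i ∈ Finset.range k, (if p i then d i else 0)| ≤ k * η := by
    intro p _ η hη k
    induction k with
    | zero =>
      intro _
      refine ⟨0, hx.left ▸ TaggedSum.nil, ?_⟩
      have h0 : I (x 0) = 0 := by
        rw [hx.left]
        exact (hI a ⟨le_rfl, hat⟩).eq_zero_of_same
      simp [h0]
    | succ k ih =>
      intro hk
      obtain ⟨S, hS, hSk⟩ := ih (by omega)
      have hlt := hx.lt_succ k (by omega)
      rw [Finset.sum_range_succ]
      by_cases hp : p k
      · refine ⟨_, hS.snoc hlt (hmesh k (by omega)) (hτ k (by omega)), ?_⟩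
        rw [if_pos hp]
        push_cast
        have : S + f (τ k) * (h (x (k + 1)) - h (x k)) - I (x (k + 1)) -
            (∑ i ∈ Finset.range k, (if p i then d i else 0) + d k) =
            S - I (x k) - ∑ i ∈ Finset.range k, (if p i then d i else 0) := by
          simp only [hd]; ring
        rw [this]
        linarith
      · obtain ⟨S', hS', hS'k⟩ := HasRSIntegral.exists_taggedSum_sub (hmem k (by omega)).1 hlt.le
          (hI _ (hmem k (by omega))) (hI _ (hmem (k + 1) hk)) hδ hη
        refine ⟨_, hS.append hS', ?_⟩
        rw [if_neg hp, add_zero]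
        push_cast
        rw [abs_le] at *
        rw [abs_lt] at hS'k
        constructor <;> linarith [hS'k.1, hS'k.2, hSk.1, hSk.2]
  have key' : ∀ (p : ℕ → Prop) [DecidablePred p], |∑ i ∈ Finset.range n, (if p i then d i else 0)| ≤ ε / 2 := by
    intro p _
    refine le_of_forall_pos_le_add fun η hη => ?_
    obtain ⟨S, hS, hSn⟩ := key p (η / (n + 1)) (by positivity) n le_rfl
    have h1 := H S (hx.right ▸ hS)
    rw [hx.right] at hSn
    have h2 : (n : ℝ) * (η / (n + 1)) ≤ η := by
      rw [mul_div_assoc', div_le_iff₀ (by positivity)]; nlinarith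
    rw [abs_le] at *
    rw [abs_lt] at h1
    constructor <;> linarith [h1.1, h1.2, hSn.1, hSn.2]
  -- Selecting the cells by the sign of `d i` turns bounds on signed sums into a bound on the sum of
  -- absolute values.
  have h1 := key' fun i => 0 ≤ d i
  have h2 := key' fun i => ¬ 0 ≤ d i
  have h3 : ∑ i ∈ Finset.range n, |d i| =
      ∑ i ∈ Finset.range n, (if 0 ≤ d i then d i else 0) -
        ∑ i ∈ Finset.range n, (if ¬ 0 ≤ d i then d i else 0) := by
    rw [← Finset.sum_sub_distrib]
    refine Finset.sum_congr rfl fun i _ => ?_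
    by_cases hi : 0 ≤ d i
    · simp [hi, abs_of_nonneg hi]
    · simp [hi, abs_of_neg (not_le.1 hi)]
  rw [h3]
  linarith [(abs_le.1 h1).2, (abs_le.1 h2).1]

/-! ### The explicit path solves the equation -/

/-- The base `x₀^{1-m} + (1-m) a ∫_0^t e^{(m-1)(bs + c h_s)} ds` of the explicit solution. -/
noncomputable def explicitBase (h : ℝ → ℝ) (x₀ a b c : ℝ) (m : ℕ) (t : ℝ) : ℝ :=
  x₀ ^ (1 - m : ℝ) + (1 - m : ℝ) * a *
    ∫ s in (0 : ℝ)..t, Real.exp ((m - 1 : ℝ) * (b * s + c * h s))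

/-- The smooth factor of the explicit solution, which is this factor times `e^{c h_t}`. -/
noncomputable def explicitFactor (h : ℝ → ℝ) (x₀ a b c : ℝ) (m : ℕ) (t : ℝ) : ℝ :=
  Real.exp (b * t) * explicitBase h x₀ a b c m t ^ (1 / (1 - m : ℝ))

/-- The derivative of `explicitFactor`. -/
noncomputable def explicitFactorDeriv (h : ℝ → ℝ) (x₀ a b c : ℝ) (m : ℕ) (t : ℝ) : ℝ :=
  b * explicitFactor h x₀ a b c m t + Real.exp (b * t) *
    (a * Real.exp ((m - 1 : ℝ) * (b * t + c * h t)) *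
      explicitBase h x₀ a b c m t ^ (1 / (1 - m : ℝ) - 1))

section ExplicitPath

variable {h : ℝ → ℝ} {x₀ a b c : ℝ} {m : ℕ} {t : ℝ}

/-- Since `a ≤ 0` and `m ≥ 2`, the coefficient `(1 - m) a` is nonnegative: the solution cannot blow
up, and the real power can be differentiated. -/
lemma explicitBase_pos (hx₀ : 0 < x₀) (ha : a ≤ 0) (hm : 2 ≤ m) (ht : 0 ≤ t) :
    0 < explicitBase h x₀ a b c m t := by
  have hm' : (2 : ℝ) ≤ m := by exact_mod_cast hm
  refine add_pos_of_pos_of_nonneg (Real.rpow_pos_of_pos hx₀ _) (mul_nonneg ?_ ?_)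
  · nlinarith
  · exact intervalIntegral.integral_nonneg ht fun s _ => (Real.exp_pos _).le

lemma continuous_exp_noise (hh : Continuous h) :
    Continuous fun s => Real.exp ((m - 1 : ℝ) * (b * s + c * h s)) := by fun_prop

lemma hasDerivAt_explicitBase (hh : Continuous h) (t : ℝ) :
    HasDerivAt (explicitBase h x₀ a b c m)
      ((1 - m : ℝ) * a * Real.exp ((m - 1 : ℝ) * (b * t + c * h t))) t :=
  (((continuous_exp_noise hh).integral_hasStrictDerivAt 0 t).hasDerivAt.const_mul _).const_add _

lemma hasDerivAt_explicitFactor (hh : Continuous h) (hx₀ : 0 < x₀) (ha : a ≤ 0) (hm : 2 ≤ m)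
    (ht : 0 ≤ t) :
    HasDerivAt (explicitFactor h x₀ a b c m) (explicitFactorDeriv h x₀ a b c m t) t := by
  have hm' : (1 - m : ℝ) ≠ 0 := by
    have : (2 : ℝ) ≤ m := by exact_mod_cast hm
    linarith
  have h1 : HasDerivAt (fun t => Real.exp (b * t)) (Real.exp (b * t) * (b * 1)) t :=
    ((hasDerivAt_id t).const_mul b).exp
  have h2 := (hasDerivAt_explicitBase (x₀ := x₀) (a := a) (b := b) (c := c) (m := m) hh
    t).rpow_const (p := 1 / (1 - m : ℝ)) (Or.inl (explicitBase_pos hx₀ ha hm ht).ne')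
  refine (h1.mul h2).congr_deriv ?_
  rw [explicitFactorDeriv, explicitFactor]
  field_simp

lemma continuousOn_explicitFactorDeriv (hh : Continuous h) (hx₀ : 0 < x₀) (ha : a ≤ 0)
    (hm : 2 ≤ m) : ContinuousOn (explicitFactorDeriv h x₀ a b c m) (Ici 0) := by
  have hb : Continuous (explicitBase h x₀ a b c m) :=
    continuous_iff_continuousAt.2 fun t => (hasDerivAt_explicitBase hh t).continuousAt
  have hr : ∀ p : ℝ, ContinuousOn (fun t => explicitBase h x₀ a b c m t ^ p) (Ici 0) := fun p =>
    hb.continuousOn.rpow_const fun t ht => Or.inl (explicitBase_pos hx₀ ha hm ht).ne'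
  have he : Continuous fun t => Real.exp (b * t) := by fun_prop
  unfold explicitFactorDeriv explicitFactor
  exact ((he.continuousOn.mul (hr _)).const_smul b).add
    (he.continuousOn.mul ((continuousOn_const.mul (continuous_exp_noise hh).continuousOn).mul
      (hr _)))

/-- The Bernoulli equation for the smooth factor; it rests on the exponent identity `m / (1 - m) = 1
/ (1 - m) - 1`. -/
lemma drift_eq (hx₀ : 0 < x₀) (ha : a ≤ 0) (hm : 2 ≤ m) (ht : 0 ≤ t) :
    a * (explicitFactor h x₀ a b c m t * Real.exp (c * h t)) ^ m +
      b * (explicitFactor h x₀ a b c m t * Real.exp (c * h t)) =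
      Real.exp (c * h t) * explicitFactorDeriv h x₀ a b c m t := by
  have hm' : (1 - m : ℝ) ≠ 0 := by
    have : (2 : ℝ) ≤ m := by exact_mod_cast hm
    linarith
  have hZ := explicitBase_pos (h := h) (b := b) (c := c) hx₀ ha hm ht
  have e1 : (explicitBase h x₀ a b c m t ^ (1 / (1 - m : ℝ))) ^ m =
      explicitBase h x₀ a b c m t ^ (1 / (1 - m : ℝ) - 1) := by
    rw [← Real.rpow_natCast, ← Real.rpow_mul hZ.le]
    congr 1
    field_simp
    ring
  have e2 : (Real.exp (b * t) * Real.exp (c * h t)) ^ m =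
      Real.exp (c * h t) * Real.exp (b * t) *
        Real.exp ((m - 1 : ℝ) * (b * t + c * h t)) := by
    rw [← Real.exp_add, ← Real.exp_nat_mul, ← Real.exp_add, ← Real.exp_add]
    congr 1
    ring
  rw [explicitFactorDeriv]
  conv_lhs => enter [1, 2, 1]; rw [explicitFactor, mul_right_comm]
  rw [mul_pow, e1, e2]
  ring

lemma isPathSolution_explicit {C γ T : ℝ} (hh : Continuous h) (h0 : h 0 = 0) (hx₀ : 0 < x₀)
    (ha : a ≤ 0) (hm : 2 ≤ m) (hγ : 1 / 2 < γ) (hC : 0 ≤ C) (hol : HolderBound C γ h T) :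
    IsPathSolution a b c m T x₀ h
      (fun t => explicitFactor h x₀ a b c m t * Real.exp (c * h t)) := by
  have hm' : (1 - m : ℝ) ≠ 0 := by
    have : (2 : ℝ) ≤ m := by exact_mod_cast hm
    linarith
  have hA : ∀ t ∈ Icc 0 T, HasDerivAt (explicitFactor h x₀ a b c m)
      (explicitFactorDeriv h x₀ a b c m t) t := fun t ht =>
    hasDerivAt_explicitFactor hh hx₀ ha hm ht.1
  have hA' : ContinuousOn (explicitFactorDeriv h x₀ a b c m) (Icc 0 T) :=
    (continuousOn_explicitFactorDeriv hh hx₀ ha hm).mono Icc_subset_Ici_self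
  have hec : Continuous fun u => Real.exp (c * u) := by fun_prop
  have hX : ContinuousOn (fun t => explicitFactor h x₀ a b c m t * Real.exp (c * h t))
      (Icc 0 T) :=
    ContinuousOn.mul (fun t ht => (hA t ht).continuousAt.continuousWithinAt)
      (hec.comp hh).continuousOn
  have he : ∀ x, HasDerivAt (fun u => Real.exp (c * u)) (Real.exp (c * x) * (c * 1)) x :=
    fun x => ((hasDerivAt_id x).const_mul c).exp
  -- An antiderivative written as an integral avoids division by `c`, so `c = 0` needs no separate
  -- treatment.
  have hE : ∀ x, HasDerivAt (fun u => ∫ v in (0 : ℝ)..u, Real.exp (c * v)) (Real.exp (c * x)) x :=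
    fun x => (hec.integral_hasStrictDerivAt 0 x).hasDerivAt
  have hEc : ∀ u, c * (∫ v in (0 : ℝ)..u, Real.exp (c * v)) = Real.exp (c * u) - 1 := by
    intro u
    have := intervalIntegral.integral_eq_sub_of_hasDerivAt (a := 0) (b := u) (fun x _ => he x)
      (by apply Continuous.intervalIntegrable; fun_prop)
    rw [intervalIntegral.integral_mul_const, mul_zero, Real.exp_zero, mul_one] at this
    rw [← this, mul_comm]
  refine ⟨hX, fun t ht => ?_, fun t ht => ?_⟩
  · refine ContinuousOn.intervalIntegrable (ContinuousOn.mono ?_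
      (uIcc_subset_Icc ⟨le_rfl, ht.1.trans ht.2⟩ ht))
    exact ((hX.pow m).const_smul a).add (hX.const_smul b)
  · refine ⟨_, hasRSIntegral_mul_comp hA hA' hE he (by fun_prop) hh.continuousOn hγ hC hol ht, ?_⟩
    have hsub : uIcc 0 t ⊆ Icc 0 T := uIcc_subset_Icc ⟨le_rfl, ht.1.trans ht.2⟩ ht
    have d1 : (∫ s in (0 : ℝ)..t, (a * (explicitFactor h x₀ a b c m s * Real.exp (c * h s)) ^ m +
        b * (explicitFactor h x₀ a b c m s * Real.exp (c * h s)))) =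
        ∫ s in (0 : ℝ)..t, Real.exp (c * h s) * explicitFactorDeriv h x₀ a b c m s :=
      intervalIntegral.integral_congr fun s hs => drift_eq hx₀ ha hm (hsub hs).1
    have d2 : c * (∫ s in (0 : ℝ)..t, (∫ v in (0 : ℝ)..h s, Real.exp (c * v)) *
        explicitFactorDeriv h x₀ a b c m s) =
        (∫ s in (0 : ℝ)..t, Real.exp (c * h s) * explicitFactorDeriv h x₀ a b c m s) -
          ∫ s in (0 : ℝ)..t, explicitFactorDeriv h x₀ a b c m s := by
      rw [← intervalIntegral.integral_const_mul, ← intervalIntegral.integral_sub]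
      · refine intervalIntegral.integral_congr fun s _ => ?_
        rw [← mul_assoc, hEc]; ring
      · exact (((hec.comp hh).continuousOn.mul hA').mono hsub).intervalIntegrable
      · exact (hA'.mono hsub).intervalIntegrable
    have d3 : (∫ s in (0 : ℝ)..t, explicitFactorDeriv h x₀ a b c m s) =
        explicitFactor h x₀ a b c m t - explicitFactor h x₀ a b c m 0 :=
      intervalIntegral.integral_eq_sub_of_hasDerivAt (fun s hs => hA s (hsub hs))
        (hA'.mono hsub).intervalIntegrable
    have d4 : explicitFactor h x₀ a b c m 0 = x₀ := by
      rw [explicitFactor, explicitBase, intervalIntegral.integral_same, mul_zero, mul_zero,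
        add_zero, Real.exp_zero, one_mul, ← Real.rpow_mul hx₀.le, mul_one_div_cancel hm',
        Real.rpow_one]
    rw [d1, h0, intervalIntegral.integral_same, mul_zero, sub_zero, mul_sub, d2, d3, d4]
    linear_combination (-explicitFactor h x₀ a b c m t) * hEc (h t)

end ExplicitPath

/-! ### Uniqueness by reduction to an ordinary differential equation -/

/-- For a continuous solution `y`, the function `y e^{-c h}` solves an ordinary integral
equation, whether or not `y` is of bounded `p`-variation. -/
lemma IsPathSolution.mul_exp_eq {a b c C γ T x₀ : ℝ} {m : ℕ} {h y : ℝ → ℝ}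
    (hy : IsPathSolution a b c m T x₀ h y) (hh : ContinuousOn h (Icc 0 T)) (hγ : 1 / 2 < γ)
    (hC : 0 ≤ C) (hol : HolderBound C γ h T) {t : ℝ} (ht : t ∈ Icc 0 T) :
    y t * Real.exp (-c * h t) = x₀ * Real.exp (-c * h 0) +
      ∫ s in (0 : ℝ)..t, Real.exp (-c * h s) * (a * y s ^ m + b * y s) := by
  have hT : 0 ≤ T := ht.1.trans ht.2
  have hyc := hy.continuousOn
  have hd : ContinuousOn (fun s => a * y s ^ m + b * y s) (Icc 0 T) :=
    ((hyc.pow m).const_smul a).add (hyc.const_smul b)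
  have hG : ContinuousOn (fun s => Real.exp (-c * h s)) (Icc 0 T) :=
    (hh.const_smul (-c)).rexp
  have hint : ∀ {f : ℝ → ℝ}, ContinuousOn f (Icc 0 T) → ∀ u ∈ Icc 0 T, ∀ v ∈ Icc 0 T,
      IntervalIntegrable f volume u v := fun hf u hu v hv =>
    (hf.mono (uIcc_subset_Icc hu hv)).intervalIntegrable
  have hex : ∀ s, ∃ I : ℝ, s ∈ Icc 0 T → HasRSIntegral y h 0 s I ∧
      y s = x₀ + (∫ r in (0 : ℝ)..s, (a * y r ^ m + b * y r)) + c * I := by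
    intro s
    by_cases hs : s ∈ Icc 0 T
    · obtain ⟨I, hI⟩ := hy.equation s hs
      exact ⟨I, fun _ => hI⟩
    · exact ⟨0, fun h => absurd h hs⟩
  choose I hI using hex
  have hy0 : y 0 = x₀ := by
    have h0 := hI 0 ⟨le_rfl, hT⟩
    rw [h0.2, h0.1.eq_zero_of_same]
    simp
  obtain ⟨M, hM0, hM⟩ := exists_abs_le_of_continuousOn_Icc hG
  obtain ⟨N, hN0, hN⟩ := exists_abs_le_of_continuousOn_Icc hyc
  set F : ℝ → ℝ := fun s => y s * Real.exp (-c * h s) -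
    ∫ r in (0 : ℝ)..s, Real.exp (-c * h r) * (a * y r ^ m + b * y r) with hF
  have he : ∀ x, HasDerivAt (fun u => Real.exp (-c * u)) (Real.exp (-c * x) * (-c * 1)) x :=
    fun x => ((hasDerivAt_id x).const_mul (-c)).exp
  have c1 := (isSmallCell_taylor he (fun x => (he x).mul_const (-c * 1)) (by fun_prop) hh hγ hC
    hol (σ := fun _ _ v => v) (fun u τ v h1 h2 => ⟨h1.trans h2, le_rfl⟩)).bdd_mul
    (g := fun u _ _ => y u) (M := N) (fun u τ v h0 h1 h2 h3 => hN u ⟨h0, (h1.trans h2).trans h3⟩)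
  have c2 := isSmallCell_integral_mul hd hG (σ := fun _ _ v => v)
    (fun u τ v h1 h2 => ⟨h1.trans h2, le_rfl⟩)
  -- Split `y_v G_v - y_u G_u = (y_v - y_u) G_v + y_u (G_v - G_u)` with `G = e^{-ch}`. Expanding `G`
  -- at `v` gives both noise terms the common factor `c G_v`, leaving exactly the error controlled
  -- by Saks–Henstock.
  have hcell : IsSmallCell T fun u _ v => F v - F u -
      c * Real.exp (-c * h v) * (I v - I u - y u * (h v - h u)) := by
    refine (c1.add c2).congr fun u τ v h0 h1 h2 h3 => ?_
    have hu : u ∈ Icc 0 T := ⟨h0, (h1.trans h2).trans h3⟩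
    have hv : v ∈ Icc 0 T := ⟨h0.trans (h1.trans h2), h3⟩
    have z : (0 : ℝ) ∈ Icc 0 T := ⟨le_rfl, hT⟩
    have e1 := intervalIntegral.integral_add_adjacent_intervals (hint hd 0 z u hu)
      (hint hd u hu v hv)
    have e2 := intervalIntegral.integral_add_adjacent_intervals (hint (hG.mul hd) 0 z u hu)
      (hint (hG.mul hd) u hu v hv)
    have e3 := (hI u hu).2
    have e4 := (hI v hv).2
    simp only [Pi.mul_apply] at e2
    simp only [hF]
    rw [← e2]
    rw [← e1] at e4
    linear_combination Real.exp (-c * h v) * (e4 - e3)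
  have key : |F t - F 0| ≤ 0 := by
    refine le_of_forall_pos_le_add fun ε hε => ?_
    obtain ⟨δ₁, hδ₁, H₁⟩ := hcell.exists_sum_le (half_pos hε)
    have hpos : 0 < ε / 2 / (|c| * M + 1) := by positivity
    obtain ⟨δ₂, hδ₂, H₂⟩ := saks_henstock ht.1
      (fun s hs => (hI s ⟨hs.1, hs.2.trans ht.2⟩).1) hpos
    -- Only the fine partition is needed; its tags are discarded in favour of left endpoints.
    obtain ⟨S, hS⟩ := TaggedSum.exists_of_le y h ht.1 (lt_min hδ₁ hδ₂)
    obtain ⟨n, x, -, hx, hmesh, -, -⟩ := hS.exists_partition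
    have htag : ∀ i < n, x i ∈ Icc (x i) (x (i + 1)) := fun i hi =>
      ⟨le_rfl, (hx.lt_succ i hi).le⟩
    have e1 := H₁ t ht n x x hx (fun i hi => (hmesh i hi).trans_le (min_le_left _ _)) htag
    have e2 := H₂ n x x hx (fun i hi => (hmesh i hi).trans_le (min_le_right _ _)) htag
    rw [Finset.sum_sub_distrib, hx.sum_sub] at e1
    have e3 : |∑ i ∈ Finset.range n, c * Real.exp (-c * h (x (i + 1))) *
        (I (x (i + 1)) - I (x i) - y (x i) * (h (x (i + 1)) - h (x i)))| ≤ ε / 2 := by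
      calc _ ≤ ∑ i ∈ Finset.range n, |c * Real.exp (-c * h (x (i + 1))) *
            (I (x (i + 1)) - I (x i) - y (x i) * (h (x (i + 1)) - h (x i)))| :=
            Finset.abs_sum_le_sum_abs _ _
        _ ≤ ∑ i ∈ Finset.range n, |c| * M *
            |y (x i) * (h (x (i + 1)) - h (x i)) - (I (x (i + 1)) - I (x i))| := by
            refine Finset.sum_le_sum fun i hi => ?_
            have hi' : i + 1 ≤ n := Finset.mem_range.1 hi
            have := hM (x (i + 1)) ⟨hx.left_le hi', (hx.le_right hi').trans ht.2⟩
            rw [abs_mul, abs_mul, abs_sub_comm (I _ - I _)]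
            gcongr
        _ ≤ (|c| * M + 1) * (ε / 2 / (|c| * M + 1)) := by
            rw [← Finset.mul_sum]
            have : 0 ≤ |c| * M := by positivity
            gcongr
            linarith
        _ = ε / 2 := by field_simp
    rw [abs_lt] at e1
    rw [abs_le] at e3 ⊢
    constructor <;> linarith [e1.1, e1.2, e3.1, e3.2]
  have hFt : F t = F 0 := by
    have := abs_nonpos_iff.1 key
    linarith
  simp only [hF, intervalIntegral.integral_same, hy0, sub_zero] at hFt
  linarith

lemma hasDerivWithinAt_of_integral_equation {w p : ℝ → ℝ} {T k : ℝ}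
    (hp : ContinuousOn p (Icc 0 T)) (hw : ∀ t ∈ Icc 0 T, w t = k + ∫ s in (0 : ℝ)..t, p s)
    {t : ℝ} (ht : t ∈ Ico 0 T) : HasDerivWithinAt w (p t) (Ici t) t := by
  have hT : 0 ≤ T := ht.1.trans ht.2.le
  -- Constant extension beyond `[0, T]` makes the integrand continuous on the line, so that the
  -- fundamental theorem also applies at `t = 0`.
  set q : ℝ → ℝ := fun s => p (projIcc 0 T hT s) with hq
  have hqc : Continuous q := hp.domRestrict.Icc_extend' (h := hT)
  have hqp : ∀ s ∈ Icc 0 T, q s = p s := fun s hs => by simp [hq, projIcc_of_mem hT hs]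
  have hd := ((hqc.integral_hasStrictDerivAt 0 t).hasDerivAt.const_add k).hasDerivWithinAt
    (s := Ici t)
  rw [hqp t ⟨ht.1, ht.2.le⟩] at hd
  have heq : ∀ s ∈ Icc 0 T, w s = k + ∫ r in (0 : ℝ)..s, q r := fun s hs => by
    rw [hw s hs]
    congr 1
    exact intervalIntegral.integral_congr fun r hr =>
      (hqp r (uIcc_subset_Icc ⟨le_rfl, hT⟩ hs hr)).symm
  refine hd.congr_of_eventuallyEq ?_ (heq t ⟨ht.1, ht.2.le⟩)
  filter_upwards [Icc_mem_nhdsGE ht.2] with s hs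
  exact heq s ⟨ht.1.trans hs.1, hs.2⟩

lemma IsPathSolution.eqOn {a b c C γ T x₀ : ℝ} {m : ℕ} {h y z : ℝ → ℝ}
    (hy : IsPathSolution a b c m T x₀ h y) (hz : IsPathSolution a b c m T x₀ h z)
    (hh : ContinuousOn h (Icc 0 T)) (hγ : 1 / 2 < γ) (hC : 0 ≤ C) (hol : HolderBound C γ h T) :
    EqOn y z (Icc 0 T) := by
  rcases lt_or_ge T 0 with hT | hT
  · simp [Icc_eq_empty_of_lt hT]
  have hG : ContinuousOn (fun s => Real.exp (-c * h s)) (Icc 0 T) :=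
    (hh.const_smul (-c)).rexp
  have hK : ContinuousOn (fun s => a * Real.exp ((m - 1 : ℝ) * (c * h s))) (Icc 0 T) :=
    ((hh.const_smul c).const_smul (m - 1 : ℝ)).rexp.const_smul a
  have hGpos : ∀ s, 0 < Real.exp (-c * h s) := fun s => Real.exp_pos _
  obtain ⟨N₁, -, hN₁⟩ := exists_abs_le_of_continuousOn_Icc (hy.continuousOn.mul hG)
  obtain ⟨N₂, -, hN₂⟩ := exists_abs_le_of_continuousOn_Icc (hz.continuousOn.mul hG)
  obtain ⟨R, hR0, hR⟩ := exists_abs_le_of_continuousOn_Icc hK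
  -- Both transformed solutions stay in `[-N, N]`, where `w ↦ w ^ m` is Lipschitz.
  set N := max N₁ N₂ with hN
  obtain ⟨L, hL⟩ := ((contDiff_id.pow m : ContDiff ℝ 1 fun w : ℝ => w ^ m).locallyLipschitz
    ).locallyLipschitzOn.exists_lipschitzOnWith_of_compact (isCompact_Icc (a := -N) (b := N))
  set v : ℝ → ℝ → ℝ := fun s w => a * Real.exp ((m - 1 : ℝ) * (c * h s)) * w ^ m + b * w with hv
  have hdrift : ∀ (x : ℝ → ℝ) (s : ℝ), Real.exp (-c * h s) * (a * x s ^ m + b * x s) =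
      v s (x s * Real.exp (-c * h s)) := by
    intro x s
    have e : Real.exp (-c * h s) =
        Real.exp ((m - 1 : ℝ) * (c * h s)) * Real.exp (-c * h s) ^ m := by
      rw [← Real.exp_nat_mul, ← Real.exp_add]
      congr 1
      ring
    simp only [hv, mul_pow]
    linear_combination (a * x s ^ m) * e
  have hderiv : ∀ x, IsPathSolution a b c m T x₀ h x → ∀ t ∈ Ico 0 T,
      HasDerivWithinAt (fun s => x s * Real.exp (-c * h s))
        (v t (x t * Real.exp (-c * h t))) (Ici t) t := by
    intro x hx t ht
    rw [← hdrift]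
    exact hasDerivWithinAt_of_integral_equation (w := fun s => x s * Real.exp (-c * h s))
      (p := fun s => Real.exp (-c * h s) * (a * x s ^ m + b * x s))
      (hG.mul (((hx.continuousOn.pow m).const_smul a).add (hx.continuousOn.const_smul b)))
      (fun s hs => hx.mul_exp_eq hh hγ hC hol hs) ht
  have hlip : ∀ t ∈ Ico 0 T, LipschitzOnWith (R.toNNReal * L + ‖b‖₊) (v t) (Icc (-N) N) := by
    intro t ht
    refine LipschitzOnWith.of_dist_le_mul fun p hp q hq => ?_
    have e1 := hL.dist_le_mul p hp q hq
    simp only [Real.dist_eq, id_eq] at *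
    have e2 := hR t ⟨ht.1, ht.2.le⟩
    have e3 : v t p - v t q = a * Real.exp ((m - 1 : ℝ) * (c * h t)) * (p ^ m - q ^ m) +
        b * (p - q) := by simp only [hv]; ring
    rw [e3]
    push_cast
    rw [Real.coe_toNNReal R hR0]
    calc _ ≤ |a * Real.exp ((m - 1 : ℝ) * (c * h t))| * |p ^ m - q ^ m| + |b| * |p - q| := by
          rw [← abs_mul, ← abs_mul]; exact abs_add_le _ _
      _ ≤ R * (L * |p - q|) + |b| * |p - q| := by gcongr
      _ = _ := by rw [Real.norm_eq_abs]; ring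
  have := ODE_solution_unique_of_mem_Icc_right hlip (hy.continuousOn.mul hG) (hderiv y hy)
    (fun t ht => abs_le.1 ((hN₁ t ⟨ht.1, ht.2.le⟩).trans (le_max_left _ _)))
    (hz.continuousOn.mul hG) (hderiv z hz)
    (fun t ht => abs_le.1 ((hN₂ t ⟨ht.1, ht.2.le⟩).trans (le_max_right _ _)))
    (by
      have hz0 : (0 : ℝ) ∈ Icc 0 T := ⟨le_rfl, hT⟩
      simp only [Pi.mul_apply]
      rw [hy.mul_exp_eq hh hγ hC hol hz0, hz.mul_exp_eq hh hγ hC hol hz0]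
      simp)
  intro t ht
  exact mul_right_cancel₀ (hGpos t).ne' (this ht)

/-! ### Dyadic chaining: from dyadic increments to a Hölder bound -/

/-- The largest dyadic number of order `n` which is at most `s`. -/
noncomputable def dyadicFloor (n : ℕ) (s : ℝ) : ℝ := (⌊2 ^ n * s⌋₊ : ℝ) / 2 ^ n

lemma dyadicFloor_le {s : ℝ} (hs : 0 ≤ s) (n : ℕ) : dyadicFloor n s ≤ s := by
  rw [dyadicFloor, div_le_iff₀ (by positivity), mul_comm]
  exact Nat.floor_le (by positivity)

lemma lt_dyadicFloor_add (s : ℝ) (n : ℕ) : s < dyadicFloor n s + 1 / 2 ^ n := by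
  rw [dyadicFloor, ← add_div, lt_div_iff₀ (by positivity), mul_comm]
  exact Nat.lt_floor_add_one _

lemma tendsto_dyadicFloor {s : ℝ} (hs : 0 ≤ s) :
    Tendsto (fun n => dyadicFloor n s) atTop (nhds s) := by
  have h : Tendsto (fun n : ℕ => s - (1 / 2 : ℝ) ^ n) atTop (nhds s) := by
    simpa using tendsto_const_nhds.sub
      (tendsto_pow_atTop_nhds_zero_of_lt_one (r := (1 / 2 : ℝ)) (by norm_num) (by norm_num))
  refine tendsto_of_tendsto_of_tendsto_of_le_of_le h tendsto_const_nhds (fun n => ?_)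
    fun n => dyadicFloor_le hs n
  have := lt_dyadicFloor_add s n
  simp only [one_div, inv_pow] at *
  linarith

section Dyadic

variable {f : ℝ → ℝ} {K r : ℝ}

lemma abs_sub_le_of_dyadic_step (hK : 0 ≤ K) (hr : 0 ≤ r)
    (H : ∀ n k : ℕ, k < 2 ^ n → |f ((k + 1) / 2 ^ n) - f (k / 2 ^ n)| ≤ K * r ^ n)
    {n i j : ℕ} (hij : i ≤ j) (hji : j ≤ i + 1) (hj : j ≤ 2 ^ n) :
    |f (j / 2 ^ n) - f (i / 2 ^ n)| ≤ K * r ^ n := by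
  rcases hij.eq_or_lt with rfl | hlt
  · simpa using by positivity
  · obtain rfl : j = i + 1 := by omega
    simpa using H n i (by omega)

lemma abs_dyadicFloor_succ_sub_le (hK : 0 ≤ K) (hr : 0 ≤ r)
    (H : ∀ n k : ℕ, k < 2 ^ n → |f ((k + 1) / 2 ^ n) - f (k / 2 ^ n)| ≤ K * r ^ n)
    {s : ℝ} (hs : s ∈ Icc (0 : ℝ) 1) (n : ℕ) :
    |f (dyadicFloor (n + 1) s) - f (dyadicFloor n s)| ≤ K * r ^ (n + 1) := by
  -- Read at order `n + 1`, successive dyadic approximations are equal or adjacent.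
  have e : dyadicFloor n s = ((2 * ⌊2 ^ n * s⌋₊ : ℕ) : ℝ) / 2 ^ (n + 1) := by
    rw [dyadicFloor]; push_cast; field_simp; ring
  rw [e, dyadicFloor]
  have h0 : 0 ≤ 2 ^ n * s := by have := hs.1; positivity
  have h1 := Nat.floor_le h0
  have h2 := Nat.lt_floor_add_one (2 ^ n * s)
  have e2 : (2 : ℝ) ^ (n + 1) * s = 2 * (2 ^ n * s) := by ring
  refine abs_sub_le_of_dyadic_step hK hr H ?_ ?_ ?_
  · apply Nat.le_floor; push_cast; linarith
  · rw [← Nat.lt_succ_iff]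
    rw [Nat.floor_lt (by rw [e2]; positivity)]
    push_cast; linarith
  · apply Nat.floor_le_of_le
    push_cast
    exact mul_le_of_le_one_right (by positivity) hs.2

lemma abs_sub_dyadicFloor_le (hf : Continuous f) (hK : 0 ≤ K) (hr : 0 ≤ r) (hr1 : r < 1)
    (H : ∀ n k : ℕ, k < 2 ^ n → |f ((k + 1) / 2 ^ n) - f (k / 2 ^ n)| ≤ K * r ^ n)
    {s : ℝ} (hs : s ∈ Icc (0 : ℝ) 1) (n : ℕ) :
    |f (dyadicFloor n s) - f s| ≤ K * r * r ^ n / (1 - r) := by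
  have := dist_le_of_le_geometric_of_tendsto r (K * r) hr1
    (f := fun n => f (dyadicFloor n s)) (fun n => by
      rw [dist_comm, Real.dist_eq]
      exact (abs_dyadicFloor_succ_sub_le hK hr H hs n).trans_eq (by ring))
    ((hf.tendsto s).comp (tendsto_dyadicFloor hs.1)) n
  rwa [Real.dist_eq] at this

/-- A continuous function whose dyadic increments of order `n` are `O(2 ^ (-nγ))` is
`γ`-Hölder on the unit interval. -/
lemma exists_holderBound_of_dyadic {γ : ℝ} (hf : Continuous f) (hK : 0 ≤ K) (hγ : 0 < γ)
    (H : ∀ n k : ℕ, k < 2 ^ n →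
      |f ((k + 1) / 2 ^ n) - f (k / 2 ^ n)| ≤ K * ((1 / 2 : ℝ) ^ γ) ^ n) :
    ∃ C, 0 ≤ C ∧ HolderBound C γ f 1 := by
  set r : ℝ := (1 / 2 : ℝ) ^ γ with hr
  have hr0 : 0 < r := Real.rpow_pos_of_pos (by norm_num) _
  have hr1 : r < 1 := Real.rpow_lt_one (by norm_num) (by norm_num) hγ
  have hr1' : 0 < 1 - r := by linarith
  -- One dyadic step of order `n` plus a geometric tail at each of the two points.
  set D : ℝ := K + 2 * (K * r / (1 - r)) with hD
  have hD0 : 0 ≤ D := by positivity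
  have key : ∀ s ∈ Icc (0 : ℝ) 1, ∀ t ∈ Icc (0 : ℝ) 1, s < t →
      |f t - f s| ≤ D / r * |t - s| ^ γ := by
    intro s hs t ht hst
    have hts : 0 < t - s := sub_pos.2 hst
    -- The order `n` satisfies `2^{-(n+1)} < t - s ≤ 2^{-n}`: the upper bound makes the two floors
    -- equal or adjacent, the lower one gives `r ^ (n + 1) ≤ |t - s| ^ γ`.
    obtain ⟨n, hn1, hn2⟩ := exists_nat_pow_near_of_lt_one hts (by linarith [ht.2, hs.1])
      (by norm_num : (0 : ℝ) < 1 / 2) (by norm_num)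
    have e1 := abs_sub_dyadicFloor_le hf hK hr0.le hr1 H hs n
    have e2 := abs_sub_dyadicFloor_le hf hK hr0.le hr1 H ht n
    have e3 : |f (dyadicFloor n t) - f (dyadicFloor n s)| ≤ K * r ^ n := by
      have h0 : (0 : ℝ) ≤ 2 ^ n * s := by have := hs.1; positivity
      have h0' : (0 : ℝ) ≤ 2 ^ n * t := by have := ht.1; positivity
      refine abs_sub_le_of_dyadic_step hK hr0.le H ?_ ?_ ?_
      · exact Nat.floor_mono (by gcongr)
      · have h2 := Nat.lt_floor_add_one (2 ^ n * s)
        have h3 : 2 ^ n * (t - s) ≤ 1 := by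
          calc 2 ^ n * (t - s) ≤ 2 ^ n * (1 / 2) ^ n := by gcongr
            _ = 1 := by rw [← mul_pow]; norm_num
        rw [← Nat.lt_succ_iff, Nat.floor_lt h0']
        push_cast
        linarith
      · apply Nat.floor_le_of_le
        push_cast
        exact mul_le_of_le_one_right (by positivity) ht.2
    have e4 : |f t - f s| ≤ D * r ^ n := by
      have h1 : f t - f s = (f (dyadicFloor n t) - f (dyadicFloor n s)) +
          (f (dyadicFloor n s) - f s) - (f (dyadicFloor n t) - f t) := by ring
      have h2 : D * r ^ n = K * r ^ n + K * r * r ^ n / (1 - r) + K * r * r ^ n / (1 - r) := by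
        rw [hD]; ring
      rw [abs_le] at *
      rw [h1, h2]
      constructor <;> linarith [e1.1, e1.2, e2.1, e2.2, e3.1, e3.2]
    have e5 : r ^ (n + 1) ≤ |t - s| ^ γ := by
      rw [abs_of_pos hts, hr, ← Real.rpow_natCast, ← Real.rpow_mul (by norm_num), mul_comm,
        Real.rpow_mul (by norm_num), Real.rpow_natCast]
      gcongr
    calc |f t - f s| ≤ D * r ^ n := e4
      _ = D / r * r ^ (n + 1) := by rw [pow_succ]; field_simp
      _ ≤ D / r * |t - s| ^ γ := by gcongr
  refine ⟨D / r, by positivity, fun s hs t ht => ?_⟩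
  rcases lt_trichotomy s t with h | rfl | h
  · exact key s hs t ht h
  · simp [Real.zero_rpow hγ.ne']
  · rw [abs_sub_comm, abs_sub_comm t]
    exact key t ht s hs h

end Dyadic

/-! ### Operations on Hölder functions and bounded variation of order `1/γ` -/

namespace HolderBound

variable {C γ T : ℝ} {h : ℝ → ℝ}

lemma of_le_exponent {γ' : ℝ} (hh : HolderBound C γ h T) (hC : 0 ≤ C) (hγ' : 0 ≤ γ')
    (hγ : γ' ≤ γ) : HolderBound (C * (|T| + 1)^ (γ - γ')) γ' h T := by
  intro s hs t ht
  refine (hh s hs t ht).trans ?_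
  rw [mul_assoc]
  refine mul_le_mul_of_nonneg_left ?_ hC
  have : |t - s| ≤ |T| + 1 := by
    have := le_abs_self T
    rw [abs_le]; constructor <;> linarith [hs.1, hs.2, ht.1, ht.2]
  calc |t - s| ^ γ = |t - s| ^ (γ - γ') * |t - s| ^ γ' := by
        rw [← Real.rpow_add_of_nonneg (abs_nonneg _) (by linarith) hγ', sub_add_cancel]
    _ ≤ _ := by gcongr

lemma comp_hasDerivAt {φ φ' : ℝ → ℝ} (hh : HolderBound C γ h T) (hhc : ContinuousOn h (Icc 0 T))
    (hφ : ∀ x, HasDerivAt φ (φ' x) x) (hφ' : Continuous φ') :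
    ∃ C', 0 ≤ C' ∧ HolderBound (C' * C) γ (fun t => φ (h t)) T := by
  obtain ⟨M, hM0, hM⟩ := exists_abs_le_of_continuousOn_Icc hhc
  obtain ⟨L, hL0, hL⟩ := exists_abs_le_of_continuousOn_Icc (hφ'.continuousOn (s := Icc (-M) M))
  refine ⟨L, hL0, fun s hs t ht => ?_⟩
  have := (convex_Icc (-M) M).norm_image_sub_le_of_norm_hasDerivWithin_le (C := L)
    (fun x _ => (hφ x).hasDerivWithinAt) hL (abs_le.1 (hM s hs)) (abs_le.1 (hM t ht))
  rw [mul_assoc]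
  exact this.trans (mul_le_mul_of_nonneg_left (hh s hs t ht) hL0)

lemma mul {D : ℝ} {k : ℝ → ℝ} (hh : HolderBound C γ h T) (hk : HolderBound D γ k T)
    (hhc : ContinuousOn h (Icc 0 T)) (hkc : ContinuousOn k (Icc 0 T)) :
    ∃ C', HolderBound C' γ (fun t => h t * k t) T := by
  obtain ⟨M, hM0, hM⟩ := exists_abs_le_of_continuousOn_Icc hhc
  obtain ⟨N, hN0, hN⟩ := exists_abs_le_of_continuousOn_Icc hkc
  refine ⟨M * D + C * N, fun s hs t ht => ?_⟩
  have e : h t * k t - h s * k s = h t * (k t - k s) + (h t - h s) * k s := by ring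
  have e1 := hh s hs t ht
  have e2 := hk s hs t ht
  rw [e]
  calc _ ≤ |h t| * |k t - k s| + |h t - h s| * |k s| := by
        rw [← abs_mul, ← abs_mul]; exact abs_add_le _ _
    _ ≤ M * (D * |t - s| ^ γ) + (C * |t - s| ^ γ) * N :=
        add_le_add (mul_le_mul (hM t ht) e2 (abs_nonneg _) hM0)
          (mul_le_mul e1 (hN s hs) (abs_nonneg _) ((abs_nonneg _).trans e1))
    _ = _ := by ring

lemma of_hasDerivAt {A A' : ℝ → ℝ} (hA : ∀ t ∈ Icc 0 T, HasDerivAt A (A' t) t)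
    (hA' : ContinuousOn A' (Icc 0 T)) : ∃ C, 0 ≤ C ∧ HolderBound C 1 A T := by
  obtain ⟨M, hM0, hM⟩ := exists_abs_le_of_continuousOn_Icc hA'
  refine ⟨M, hM0, fun s hs t ht => ?_⟩
  rw [Real.rpow_one]
  exact (convex_Icc 0 T).norm_image_sub_le_of_norm_hasDerivWithin_le (C := M)
    (fun x hx => (hA x hx).hasDerivWithinAt) hM hs ht

/-- Raised to the power `1/γ`, an increment is at most `C^{1/γ}` times the length of its cell, and
the lengths add up to `T`. -/
lemma pVariation_lt_top (hh : HolderBound C γ h T) (hC : 0 ≤ C) (hγ : 0 < γ) :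
    pVariation (1 / γ) h 0 T < ⊤ := by
  refine lt_of_le_of_lt (b := ENNReal.ofReal (C ^ (1 / γ) * T)) ?_ ENNReal.ofReal_lt_top
  refine iSup_le fun n => iSup_le fun x => iSup_le fun hx => ?_
  rw [← ENNReal.ofReal_sum_of_nonneg fun i _ => Real.rpow_nonneg (abs_nonneg _) _]
  refine ENNReal.ofReal_le_ofReal ?_
  calc _ ≤ ∑ i ∈ Finset.range n, C ^ (1 / γ) * (x (i + 1) - x i) := by
        refine Finset.sum_le_sum fun i hi => ?_
        have hi' := Finset.mem_range.1 hi
        have hlt := hx.lt_succ i hi'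
        have := hh (x i) ⟨hx.left_le hi'.le, hx.le_right hi'.le⟩ (x (i + 1))
          ⟨hx.left_le hi', hx.le_right hi'⟩
        rw [abs_of_pos (sub_pos.2 hlt)] at this
        calc _ ≤ (C * (x (i + 1) - x i) ^ γ) ^ (1 / γ) := by gcongr
          _ = _ := by
            rw [Real.mul_rpow hC (Real.rpow_nonneg (sub_pos.2 hlt).le _),
              ← Real.rpow_mul (sub_pos.2 hlt).le, mul_one_div_cancel hγ.ne', Real.rpow_one]
    _ = C ^ (1 / γ) * T := by rw [← Finset.mul_sum, hx.sum_sub (fun s => s), sub_zero]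

end HolderBound

/-! ### Hölder regularity of fractional Brownian paths -/

namespace IsFractionalBrownianMotion

variable {Ω : Type*} [MeasurableSpace Ω] {P : Measure Ω} {H : ℝ} {B : ℝ≥0 → Ω → ℝ}

lemma memLp_two (hB : IsFractionalBrownianMotion H B P) (t : ℝ≥0) : MemLp (B t) 2 P :=
  (hB.gaussian.hasGaussianLaw_eval t).memLp_two

lemma integral_increment_sq [IsProbabilityMeasure P] (hB : IsFractionalBrownianMotion H B P)
    (hH : 0 < H) (s t : ℝ≥0) :
    ∫ ω, (B t ω - B s ω) ^ 2 ∂P = |(t : ℝ) - s| ^ (2 * H) := by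
  have hint : ∀ u v, Integrable (fun ω => B u ω * B v ω) P := fun u v =>
    (hB.memLp_two u).integrable_mul (hB.memLp_two v)
  have e : ∀ ω, (B t ω - B s ω) ^ 2 = B t ω * B t ω - 2 * (B t ω * B s ω) + B s ω * B s ω :=
    fun ω => by ring
  simp_rw [e]
  rw [integral_add (f := fun ω => B t ω * B t ω - 2 * (B t ω * B s ω))
      ((hint t t).sub ((hint t s).const_mul 2)) (hint s s), integral_sub (hint t t) ((hint t s).const_mul 2), integral_const_mul,
    hB.covariance, hB.covariance, hB.covariance, sub_self, sub_self, abs_zero,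
    Real.zero_rpow (by positivity)]
  ring

lemma map_increment [IsProbabilityMeasure P] (hB : IsFractionalBrownianMotion H B P)
    (hH : 0 < H) (s t : ℝ≥0) :
    P.map (fun ω => B t ω - B s ω) =
      (gaussianReal 0 1).map (fun x => |(t : ℝ) - s| ^ H * x) := by
  have hint : ∀ u, Integrable (B u) P := fun u => (hB.memLp_two u).integrable one_le_two
  have hmean : ∫ ω, (B t ω - B s ω) ∂P = 0 := by
    rw [integral_sub (hint t) (hint s), hB.centered, hB.centered, sub_self]
  have hG : HasGaussianLaw (fun ω => B t ω - B s ω) P := hB.gaussian.hasGaussianLaw_fun_sub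
  have hvar : Var[fun ω => B t ω - B s ω; P] = (|(t : ℝ) - s| ^ H) ^ 2 := by
    rw [variance_eq_integral hG.aemeasurable, hmean]
    simp_rw [sub_zero]
    rw [hB.integral_increment_sq hH, ← Real.rpow_mul_natCast (abs_nonneg _), mul_comm]
    norm_num
  rw [hG.map_eq_gaussianReal, hmean, hvar, gaussianReal_map_const_mul, mul_zero, mul_one]
  congr 1
  ext
  simp [Real.coe_toNNReal _ (sq_nonneg _)]

lemma lintegral_increment_pow [IsProbabilityMeasure P] (hB : IsFractionalBrownianMotion H B P)
    (hH : 0 < H) (s t : ℝ≥0) {d : ℝ} (hd : 0 ≤ d) (p : ℕ) :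
    ∫⁻ ω, ENNReal.ofReal ((d * |B t ω - B s ω|) ^ p) ∂P =
      ENNReal.ofReal ((d * |(t : ℝ) - s| ^ H) ^ p) *
        ∫⁻ x, ENNReal.ofReal (|x| ^ p) ∂gaussianReal 0 1 := by
  have hm : Measurable fun x : ℝ => ENNReal.ofReal ((d * |x|) ^ p) := by fun_prop
  have hG : HasGaussianLaw (fun ω => B t ω - B s ω) P := hB.gaussian.hasGaussianLaw_fun_sub
  rw [← lintegral_map' hm.aemeasurable hG.aemeasurable, hB.map_increment hH,
    lintegral_map hm (by fun_prop), ← lintegral_const_mul _ (by fun_prop)]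
  refine lintegral_congr fun x => ?_
  rw [← ENNReal.ofReal_mul (by positivity), ← mul_pow, abs_mul,
    abs_of_nonneg (Real.rpow_nonneg (abs_nonneg _) _), mul_assoc]

/-- Kolmogorov's argument: sum the `p`-th powers of all dyadic increments, weighted by `2^{γ n p}`.
Order `n` has `2^n` terms, each of expectation proportional to `ρ^{pn}` with `ρ = 2^{γ - H} < 1`, so
once `2 ρ^p < 1` the total has finite expectation. It is then almost surely finite and dominates
each of its terms. -/
lemma ae_exists_dyadic_bound [IsProbabilityMeasure P] (hB : IsFractionalBrownianMotion H B P)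
    {γ : ℝ} (hγ : 0 < γ) (hγH : γ < H) (T : ℝ≥0) :
    ∀ᵐ ω ∂P, ∃ K : ℝ, 0 ≤ K ∧ ∀ n k : ℕ, k < 2 ^ n →
      |B (T * ((k + 1) / 2 ^ n)) ω - B (T * (k / 2 ^ n)) ω| ≤ K * ((1 / 2 : ℝ) ^ γ) ^ n := by
  have hH : 0 < H := hγ.trans hγH
  set ρ : ℝ := 2 ^ γ * (1 / 2) ^ H with hρ
  have hρ0 : 0 < ρ := by positivity
  have hρ1 : ρ < 1 := by
    rw [hρ, one_div, Real.inv_rpow two_pos.le, ← div_eq_mul_inv, ← Real.rpow_sub two_pos]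
    exact Real.rpow_lt_one_of_one_lt_of_neg one_lt_two (by linarith)
  obtain ⟨p, hp⟩ : ∃ p : ℕ, ρ ^ p < 1 / 2 := exists_pow_lt_of_lt_one (by norm_num) hρ1
  have hp0 : p ≠ 0 := by
    rintro rfl
    norm_num at hp
  set S : Ω → ℝ≥0∞ := fun ω => ∑' n : ℕ, ∑ k ∈ Finset.range (2 ^ n),
    ENNReal.ofReal ((((2 : ℝ) ^ γ) ^ n *
      |B (T * ((k + 1) / 2 ^ n)) ω - B (T * (k / 2 ^ n)) ω|) ^ p) with hS
  set Mp : ℝ≥0∞ := ∫⁻ x, ENNReal.ofReal (|x| ^ p) ∂gaussianReal 0 1 with hMp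
  have hMp_top : Mp < ⊤ := by
    have h1 : MemLp id p (gaussianReal 0 1) := memLp_id_gaussianReal' p (by simp)
    have h2 := h1.integrable_norm_pow hp0
    simpa [hMp, ofReal_integral_eq_lintegral_ofReal] using
      (hasFiniteIntegral_iff_ofReal (ae_of_all _ fun x : ℝ => by positivity)).1
        h2.hasFiniteIntegral
  have hmeas : ∀ n k : ℕ, AEMeasurable (fun ω => ENNReal.ofReal ((((2 : ℝ) ^ γ) ^ n *
      |B (T * ((k + 1) / 2 ^ n)) ω - B (T * (k / 2 ^ n)) ω|) ^ p)) P := by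
    intro n k
    have h1 := hB.gaussian.aemeasurable (T * ((k + 1) / 2 ^ n))
    have h2 := hB.gaussian.aemeasurable (T * (k / 2 ^ n))
    exact ((((h1.sub h2).abs).const_mul _).pow_const p).ennreal_ofReal
  have hterm : ∀ n k : ℕ, ∫⁻ ω, ENNReal.ofReal ((((2 : ℝ) ^ γ) ^ n *
      |B (T * ((k + 1) / 2 ^ n)) ω - B (T * (k / 2 ^ n)) ω|) ^ p) ∂P =
      ENNReal.ofReal (((T : ℝ) ^ H) ^ p * (ρ ^ p) ^ n) * Mp := by
    intro n k
    rw [hB.lintegral_increment_pow hH _ _ (by positivity)]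
    congr 2
    have e : ((T * ((k + 1) / 2 ^ n) : ℝ≥0) : ℝ) - ((T * (k / 2 ^ n) : ℝ≥0) : ℝ) =
        T * (1 / 2) ^ n := by
      push_cast
      rw [one_div_pow]
      ring
    rw [e, abs_of_nonneg (by positivity), Real.mul_rpow (by positivity) (by positivity),
      ← Real.rpow_natCast_mul (by norm_num), mul_comm (n : ℝ) H,
      Real.rpow_mul_natCast (by norm_num), hρ, ← pow_mul, mul_comm p n, pow_mul, ← mul_pow]
    congr 1
    rw [mul_pow]
    ring
  have hfin : ∫⁻ ω, S ω ∂P ≠ ⊤ := by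
    have e1 : ∫⁻ ω, S ω ∂P =
        ∑' n : ℕ, ENNReal.ofReal (((T : ℝ) ^ H) ^ p) * Mp * ENNReal.ofReal (2 * ρ ^ p) ^ n := by
      rw [hS, lintegral_tsum fun n => Finset.aemeasurable_fun_sum _ fun k _ => hmeas n k]
      refine tsum_congr fun n => ?_
      rw [lintegral_finsetSum' _ fun k _ => hmeas n k]
      simp_rw [hterm]
      rw [Finset.sum_const, Finset.card_range, nsmul_eq_mul,
        ENNReal.ofReal_mul (by positivity), ENNReal.ofReal_mul two_pos.le, mul_pow,
        ENNReal.ofReal_pow (by positivity) n]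
      push_cast
      rw [ENNReal.ofReal_ofNat]
      ring
    rw [e1, ENNReal.tsum_mul_left, ENNReal.tsum_geometric]
    refine ENNReal.mul_ne_top (ENNReal.mul_ne_top ENNReal.ofReal_ne_top hMp_top.ne) ?_
    rw [ENNReal.inv_ne_top, ne_eq, tsub_eq_zero_iff_le, not_le, ENNReal.ofReal_lt_one]
    linarith
  have hSmeas : AEMeasurable S P :=
    AEMeasurable.tsum fun n => Finset.aemeasurable_fun_sum _ fun k _ => hmeas n k
  filter_upwards [ae_lt_top' hSmeas hfin] with ω hω
  -- The `+ 1` replaces a `p`-th root: a nonnegative number is at most `1` or at most its `p`-th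
  -- power.
  refine ⟨(S ω).toReal + 1, by positivity, fun n k hk => ?_⟩
  set x := |B (T * ((k + 1) / 2 ^ n)) ω - B (T * (k / 2 ^ n)) ω| with hx
  have h1 : ENNReal.ofReal ((((2 : ℝ) ^ γ) ^ n * x) ^ p) ≤ S ω :=
    (Finset.single_le_sum (f := fun k : ℕ => ENNReal.ofReal ((((2 : ℝ) ^ γ) ^ n *
      |B (T * ((k + 1) / 2 ^ n)) ω - B (T * (k / 2 ^ n)) ω|) ^ p))
      (fun _ _ => zero_le) (Finset.mem_range.2 hk)).trans
      (ENNReal.le_tsum (f := fun n : ℕ => ∑ k ∈ Finset.range (2 ^ n), ENNReal.ofReal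
        ((((2 : ℝ) ^ γ) ^ n *
          |B (T * ((k + 1) / 2 ^ n)) ω - B (T * (k / 2 ^ n)) ω|) ^ p)) n)
  rw [ENNReal.ofReal_le_iff_le_toReal hω.ne] at h1
  have hx0 : 0 ≤ ((2 : ℝ) ^ γ) ^ n * x := by positivity
  have h2 : ((2 : ℝ) ^ γ) ^ n * x ≤ (S ω).toReal + 1 := by
    rcases le_total (((2 : ℝ) ^ γ) ^ n * x) 1 with h | h
    · have : 0 ≤ (S ω).toReal := ENNReal.toReal_nonneg
      linarith
    · have := le_self_pow₀ h hp0
      linarith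
  rw [Real.div_rpow one_pos.le two_pos.le, Real.one_rpow, one_div, inv_pow, ← div_eq_mul_inv,
    le_div_iff₀ (by positivity), mul_comm]
  exact h2

lemma continuous_samplePath (hB : IsFractionalBrownianMotion H B P) (ω : Ω) :
    Continuous (samplePath B ω) := (hB.continuous ω).comp continuous_real_toNNReal

/-- One null set must serve all `γ < H`, so the dyadic bound is taken along the countable family `H
- H / (n + 2)` increasing to `H`, and smaller exponents follow on the bounded interval. Time is
rescaled by `T` to use the unit interval. -/
lemma ae_holderBound [IsProbabilityMeasure P] (hB : IsFractionalBrownianMotion H B P)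
    (hH : 0 < H) {T : ℝ≥0} (hT : 0 < T) :
    ∀ᵐ ω ∂P, ∀ γ : ℝ, 0 < γ → γ < H →
      ∃ C, 0 ≤ C ∧ HolderBound C γ (samplePath B ω) T := by
  have hpos : ∀ n : ℕ, 0 < H - H / (n + 2) := fun n => by
    rw [sub_pos, div_lt_iff₀ (by positivity)]
    nlinarith [(Nat.cast_nonneg n : (0 : ℝ) ≤ n)]
  have hlt : ∀ n : ℕ, H - H / (n + 2) < H := fun n => by
    have : 0 < H / ((n : ℝ) + 2) := by positivity
    linarith
  have hT' : (0 : ℝ) < T := hT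
  filter_upwards [ae_all_iff.2 fun n => hB.ae_exists_dyadic_bound (hpos n) (hlt n) T]
    with ω hω γ hγ hγH
  obtain ⟨n, hn⟩ := exists_nat_gt (H / (H - γ))
  have hγn : γ ≤ H - H / (n + 2) := by
    have h1 : 0 < H - γ := sub_pos.2 hγH
    rw [div_lt_iff₀ h1] at hn
    have : H / (n + 2) ≤ H - γ := by
      rw [div_le_iff₀ (by positivity)]
      nlinarith
    linarith
  obtain ⟨K, hK, hdy⟩ := hω n
  obtain ⟨C, hC, hol⟩ := exists_holderBound_of_dyadic
    (f := fun s => samplePath B ω (T * s)) (hγ := hpos n) (K := K)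
    ((hB.continuous_samplePath ω).comp (continuous_const.mul continuous_id)) hK
    (fun i k hk => by
      have e : ∀ q : ℝ≥0, samplePath B ω (T * (q : ℝ)) = B (T * q) ω := fun q => by
        rw [samplePath, ← NNReal.coe_mul, Real.toNNReal_coe]
      have := hdy i k hk
      rw [← e, ← e] at this
      push_cast at this
      exact this)
  set δ := H - H / (n + 2) with hδ
  have hol' : HolderBound (C * (1 / T) ^ δ) δ (samplePath B ω) T := by
    intro s hs t ht
    have hmem : ∀ u ∈ Icc (0 : ℝ) T, u / T ∈ Icc (0 : ℝ) 1 := fun u hu =>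
      ⟨div_nonneg hu.1 hT'.le, (div_le_one hT').2 hu.2⟩
    have := hol _ (hmem s hs) _ (hmem t ht)
    beta_reduce at this
    rw [mul_div_cancel₀ _ hT'.ne', mul_div_cancel₀ _ hT'.ne'] at this
    refine this.trans_eq ?_
    rw [← sub_div, mul_assoc, ← Real.mul_rpow (by positivity) (abs_nonneg _), abs_div,
      abs_of_pos hT']
    congr 2
    ring
  exact ⟨_, by positivity, hol'.of_le_exponent (by positivity) hγ.le hγn⟩

lemma ae_zero [IsProbabilityMeasure P] (hB : IsFractionalBrownianMotion H B P) (hH : 0 < H) :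
    ∀ᵐ ω ∂P, B 0 ω = 0 := by
  have h1 := hB.covariance 0 0
  have hH2 : 2 * H ≠ 0 := by positivity
  simp only [NNReal.coe_zero, sub_self, abs_zero, Real.zero_rpow hH2, add_zero, zero_div] at h1
  rw [integral_eq_zero_iff_of_nonneg (fun ω => mul_self_nonneg _)
    ((hB.memLp_two 0).integrable_mul (hB.memLp_two 0))] at h1
  filter_upwards [h1] with ω hω
  exact mul_self_eq_zero.1 hω

end IsFractionalBrownianMotion

/-! ### Adaptedness, transfer to sample paths, and the theorem -/

section ExplicitProcess

variable {Ω : Type*} {B : ℝ≥0 → Ω → ℝ} {ξ : Ω → ℝ} {a b c : ℝ} {m : ℕ}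

lemma samplePath_explicitProcess (ω : Ω) {t : ℝ} (ht : 0 ≤ t) :
    samplePath (explicitProcess B ξ a b c m) ω t =
      explicitFactor (samplePath B ω) (ξ ω) a b c m t * Real.exp (c * samplePath B ω t) := by
  simp only [samplePath, explicitProcess, explicitFactor, explicitBase, Real.coe_toNNReal t ht,
    Real.exp_add]
  ring

lemma measurable_explicitProcess {mΩ : MeasurableSpace Ω} {t : ℝ≥0}
    (hBc : ∀ ω, Continuous fun t => B t ω) (hB : ∀ s ≤ t, Measurable (B s)) (hξ : Measurable ξ) :
    Measurable (explicitProcess B ξ a b c m t) := by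
  have hint : Measurable fun ω => ∫ s in (0 : ℝ)..t,
      Real.exp ((m - 1 : ℝ) * (b * s + c * samplePath B ω s)) := by
    -- Stopping the noise at `t` leaves the integral unchanged and makes the integrand measurable
    -- for every real `s` with respect to the information up to `t`; continuity in `s` then gives
    -- joint measurability.
    have e : (fun ω => ∫ s in (0 : ℝ)..t,
        Real.exp ((m - 1 : ℝ) * (b * s + c * samplePath B ω s))) = fun ω => ∫ s in (0 : ℝ)..t,
        Real.exp ((m - 1 : ℝ) * (b * s + c * B (min s.toNNReal t) ω)) := by
      funext ω
      refine intervalIntegral.integral_congr fun s hs => ?_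
      rw [uIcc_of_le t.coe_nonneg] at hs
      rw [samplePath, min_eq_left (Real.toNNReal_le_iff_le_coe.2 hs.2)]
    have hu : Measurable (Function.uncurry fun (s : ℝ) ω =>
        Real.exp ((m - 1 : ℝ) * (b * s + c * B (min s.toNNReal t) ω))) := by
      refine measurable_uncurry_of_continuous_of_measurable (fun ω => ?_) fun s => ?_
      · have := (hBc ω).comp (continuous_real_toNNReal.min (continuous_const (y := t)))
        simp only [Function.comp_def] at this
        fun_prop
      · have := hB (min s.toNNReal t) (min_le_right _ _)
        fun_prop
    rw [e]
    simp_rw [intervalIntegral.integral_of_le t.coe_nonneg]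
    exact hu.stronglyMeasurable.integral_prod_left.measurable
  have hBt := hB t le_rfl
  unfold explicitProcess
  fun_prop

end ExplicitProcess

lemma HasRSIntegral.congr {f g h : ℝ → ℝ} {a b I : ℝ} (hf : HasRSIntegral f h a b I)
    (hfg : EqOn f g (Icc a b)) : HasRSIntegral g h a b I := by
  intro ε hε
  obtain ⟨δ, hδ, H⟩ := hf ε hε
  refine ⟨δ, hδ, fun n x τ hx hmesh hτ => ?_⟩
  rw [← Finset.sum_congr rfl fun i hi => ?_]
  · exact H n x τ hx hmesh hτ
  · have hi' := Finset.mem_range.1 hi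
    rw [hfg ⟨(hx.left_le hi'.le).trans (hτ i hi').1, (hτ i hi').2.trans (hx.le_right hi')⟩]

lemma IsPathSolution.congr {a b c T x₀ : ℝ} {m : ℕ} {h y z : ℝ → ℝ}
    (hy : IsPathSolution a b c m T x₀ h y) (hyz : EqOn y z (Icc 0 T)) :
    IsPathSolution a b c m T x₀ h z := by
  have hd : ∀ t ∈ Icc 0 T, EqOn (fun s => a * y s ^ m + b * y s)
      (fun s => a * z s ^ m + b * z s) (uIcc 0 t) := fun t ht s hs => by
    have := hyz (uIcc_subset_Icc ⟨le_rfl, ht.1.trans ht.2⟩ ht hs)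
    simp only [this]
  refine ⟨hy.continuousOn.congr hyz.symm, fun t ht => ?_, fun t ht => ?_⟩
  · exact (hy.integrable t ht).congr ((hd t ht).mono uIoc_subset_uIcc)
  · obtain ⟨I, hI, he⟩ := hy.equation t ht
    refine ⟨I, hI.congr (hyz.mono (Icc_subset_Icc_right ht.2)), ?_⟩
    rw [← hyz ht, he, intervalIntegral.integral_congr (hd t ht)]

lemma pVariation_congr {p a b : ℝ} {f g : ℝ → ℝ} (hfg : EqOn f g (Icc a b)) :
    pVariation p f a b = pVariation p g a b := by
  unfold pVariation
  refine iSup_congr fun n => iSup_congr fun x => iSup_congr fun hx =>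
    Finset.sum_congr rfl fun i hi => ?_
  have hi' := Finset.mem_range.1 hi
  rw [hfg ⟨hx.left_le hi', hx.le_right hi'⟩, hfg ⟨hx.left_le hi'.le, hx.le_right hi'.le⟩]

/-- The smooth factor is Lipschitz, hence `γ`-Hölder because `γ ≤ 1`; `e^{ch}` inherits the exponent
of `h`, and so does the product. -/
lemma memCW_explicit {h : ℝ → ℝ} {x₀ a b c C γ T : ℝ} {m : ℕ} (hh : Continuous h) (hx₀ : 0 < x₀)
    (ha : a ≤ 0) (hm : 2 ≤ m) (hγ : 0 < γ) (hγ1 : γ ≤ 1) (hol : HolderBound C γ h T) (hT : 0 < T) :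
    MemCW (1 / γ) (fun t => explicitFactor h x₀ a b c m t * Real.exp (c * h t)) 0 T := by
  have hA : ∀ t ∈ Icc 0 T, HasDerivAt (explicitFactor h x₀ a b c m)
      (explicitFactorDeriv h x₀ a b c m t) t := fun t ht =>
    hasDerivAt_explicitFactor hh hx₀ ha hm ht.1
  have hA' : ContinuousOn (explicitFactorDeriv h x₀ a b c m) (Icc 0 T) :=
    (continuousOn_explicitFactorDeriv hh hx₀ ha hm).mono Icc_subset_Ici_self
  have hAc : ContinuousOn (explicitFactor h x₀ a b c m) (Icc 0 T) := fun t ht =>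
    (hA t ht).continuousAt.continuousWithinAt
  have hec : ContinuousOn (fun t => Real.exp (c * h t)) (Icc 0 T) := by fun_prop
  have he : ∀ x, HasDerivAt (fun u => Real.exp (c * u)) (Real.exp (c * x) * (c * 1)) x :=
    fun x => ((hasDerivAt_id x).const_mul c).exp
  obtain ⟨C₁, hC₁, h₁⟩ := HolderBound.of_hasDerivAt hA hA'
  obtain ⟨C₂, -, h₂⟩ := hol.comp_hasDerivAt hh.continuousOn he (by fun_prop)
  obtain ⟨C₃, h₃⟩ := (h₁.of_le_exponent hC₁ hγ.le hγ1).mul h₂ hAc hec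
  exact ⟨hAc.mul hec, h₃.pVariation_lt_top (h₃.nonneg_const hT) hγ⟩

theorem mainTheorem4 {Ω : Type*} [mΩ : MeasurableSpace Ω] (P : Measure Ω) [IsProbabilityMeasure P]
    (𝓕 : Filtration ℝ≥0 mΩ) (H : ℝ) (hH : 1 / 2 < H) (hH1 : H < 1)
    (B : ℝ≥0 → Ω → ℝ) (hB : IsFractionalBrownianMotion H B P)
    (hBad : ∀ t, Measurable[𝓕 t] (B t))
    (ξ : Ω → ℝ) (hξm : Measurable[𝓕 0] ξ) (hξ : ∀ᵐ ω ∂P, 0 < ξ ω)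
    (m : ℕ) (hm : 2 ≤ m) (a b c : ℝ) (ha : a ≤ 0) (T : ℝ≥0) (hT : 0 < T) :
    -- the paths belong to the class of continuous functions of bounded variation of that order
    (∀ᵐ ω ∂P, ∀ ε : ℝ, 0 < ε → ε < H →
      MemCW (1 / (H - ε)) (samplePath (explicitProcess B ξ a b c m) ω) 0 T) ∧
    -- the process solves the equation
    IsSDESolution P 𝓕 B ξ a b c m T (explicitProcess B ξ a b c m) ∧
    -- for almost every path of the noise the pathwise equation has no other continuous solution
    (∀ᵐ ω ∂P, ∀ y : ℝ → ℝ, IsPathSolution a b c m T (ξ ω) (samplePath B ω) y →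
      EqOn y (samplePath (explicitProcess B ξ a b c m) ω) (Icc 0 T)) ∧
    -- every solution is indistinguishable from the process
    (∀ Y : ℝ≥0 → Ω → ℝ, IsSDESolution P 𝓕 B ξ a b c m T Y →
      ∀ᵐ ω ∂P, ∀ t ≤ T, Y t ω = explicitProcess B ξ a b c m t ω) := by
  have hH0 : 0 < H := by linarith
  have hT' : (0 : ℝ) < T := hT
  -- Any exponent strictly between `1/2` and `H` would do.
  set γ : ℝ := (1 / 2 + H) / 2 with hγ
  have hγ1 : 1 / 2 < γ := by rw [hγ]; linarith
  have hγH : γ < H := by rw [hγ]; linarith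
  have heq : ∀ ω, EqOn
      (fun t => explicitFactor (samplePath B ω) (ξ ω) a b c m t * Real.exp (c * samplePath B ω t))
      (samplePath (explicitProcess B ξ a b c m) ω) (Icc 0 T) := fun ω t ht =>
    (samplePath_explicitProcess ω ht.1).symm
  have hsol : ∀ᵐ ω ∂P, IsPathSolution a b c m T (ξ ω) (samplePath B ω)
      (samplePath (explicitProcess B ξ a b c m) ω) := by
    filter_upwards [hB.ae_holderBound hH0 hT, hB.ae_zero hH0, hξ] with ω hω h0 hpos
    obtain ⟨C, hC, hol⟩ := hω γ (by linarith) hγH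
    exact (isPathSolution_explicit (hB.continuous_samplePath ω) (by simpa [samplePath] using h0)
      hpos ha hm hγ1 hC hol).congr (heq ω)
  have huniq : ∀ᵐ ω ∂P, ∀ y : ℝ → ℝ, IsPathSolution a b c m T (ξ ω) (samplePath B ω) y →
      EqOn y (samplePath (explicitProcess B ξ a b c m) ω) (Icc 0 T) := by
    filter_upwards [hB.ae_holderBound hH0 hT, hsol] with ω hω hX y hy
    obtain ⟨C, hC, hol⟩ := hω γ (by linarith) hγH
    exact hy.eqOn hX (hB.continuous_samplePath ω).continuousOn hγ1 hC hol
  refine ⟨?_, ⟨fun t _ => ?_, ?_, hsol⟩, huniq, fun Y hY => ?_⟩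
  · filter_upwards [hB.ae_holderBound hH0 hT, hξ] with ω hω hpos ε hε hεH
    obtain ⟨C, hC, hol⟩ := hω (H - ε) (by linarith) (by linarith)
    obtain ⟨h1, h2⟩ := memCW_explicit (a := a) (b := b) (c := c) (hB.continuous_samplePath ω) hpos
      ha hm (by linarith) (by linarith) hol hT'
    exact ⟨h1.congr (heq ω).symm, pVariation_congr (heq ω) ▸ h2⟩
  · exact measurable_explicitProcess hB.continuous
      (fun s hs => (hBad s).mono (𝓕.mono hs) le_rfl) (hξm.mono (𝓕.mono zero_le) le_rfl)
  · filter_upwards [hsol] with ω hω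
    obtain ⟨I, hI, he⟩ := hω.equation 0 ⟨le_rfl, hT'.le⟩
    rw [hI.eq_zero_of_same, intervalIntegral.integral_same] at he
    simpa [samplePath] using he
  · filter_upwards [huniq, hY.equation] with ω hω hYω t ht
    simpa [samplePath] using hω _ hYω ⟨t.2, ht⟩
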